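/- Let $N$ be an odd composite positive integer, let $m$ be an integer prime to $N$, let $P$ be the multiplicative order of $m$ modulo $N$ (the period of $f(a)=m^a \bmod N$), and let $Q=2^L$ be the power of $2$ with $N^2\le Q<2N^2$. Write $S_Q=\{0,1,\dots,Q-1\}$, $\omega=e^{2\pi i/Q}$, and let $\mathcal F=Q^{-1/2}(\omega^{xy})_{x,y\in S_Q}$ be the $Q$-point Fourier transform. One run of the quantum part of Shor's algorithm starts with two $L$-qubit registers in the state $|0\rangle|0\rangle$, applies $\mathcal F$ to the first register, applies the unitary $U_f:|x\rangle|b\rangle\mapsto|x\rangle|b+f(x)\bmod Q\rangle$ (so that $|x\rangle|0\rangle\mapsto|x\rangle|f(x)\rangle$), applies $\mathcal F$ to the first register again, and finally (STEP 2.4) measures the first register in the standard basis, which yields a random $y\in S_Q$. Let $\{a\}_Q$ denote the residue of $a$ modulo $Q$ in $(-Q/2,Q/2]$, let $Y=\{y\in S_Q : |\{Py\}_Q|\le P/2\}$, and let $d(y)=\mathrm{round}(Py/Q)$. Let $\lg$ be the logarithm to base $2$ and $\gamma$ Euler's constant. (1) There is a monotone decreasing sequence $\epsilon(1)\ge\epsilon(2)\ge\cdots$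 of positive reals converging to $0$ (the same for all $N$ and $m$) such that, for all $N$ and $m$ as above, $$\mathrm{Prob}\{y\in Y \mid \gcd(d(y),P)=1\}\ \ge\ \frac{4}{\pi^2\ln 2}\cdot\frac{e^{-\gamma}-\epsilon(P)}{\lg\lg N}\cdot\left(1-\frac1N\right)^2 ,$$ where the left-hand side is the probability that the measured $y$ lies in $Y$ and satisfies $\gcd(d(y),P)=1$. (2) This probability is $\Omega(1/\lg\lg N)$, uniformly in $m$: there is a constant $c>0$ such that it is at least $c/\lg\lg N$ for all $N$ and $m$ as above. (3) $O(\lg\lg N)$ repetitions succeed with probability $\Omega(1)$: for every constant $C>0$ there is a constant $\delta>0$ such that, for all $N$ and $m$ as above, among $\lceil C\lg\lg N\rceil$ independent runs at least one yields a $y\in Y$ with $\gcd(d(y),P)=1$ with probability at least $\delta$. -/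

import Mathlib

open scoped Matrix Kronecker

noncomputable section

namespace Shor

/-- The label set `S_Q = {0, …, Q - 1}` of the standard basis of an `L`-qubit register,
where `Q = 2 ^ L`. -/
abbrev Reg (L : ℕ) : Type := Fin (2 ^ L)

/-- Amplitudes, in the standard basis, of a state of two `L`-qubit registers. -/
abbrev State (L : ℕ) : Type := Reg L × Reg L → ℂ

/-- The root of unity `ω = e^{2πi/Q}`, `Q = 2 ^ L`. -/
def omega (L : ℕ) : ℂ := Complex.exp (2 * Real.pi * Complex.I / ((2 ^ L : ℕ) : ℂ))

/-- The `Q`-point Fourier transform `Q^{-1/2} (ω^{xy})`. -/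
def fourier (L : ℕ) : Matrix (Reg L) (Reg L) ℂ :=
  Matrix.of fun y x => ((Real.sqrt ((2 ^ L : ℕ) : ℝ) : ℝ) : ℂ)⁻¹ * omega L ^ ((x : ℕ) * (y : ℕ))

/-- The unitary `U_f : |x⟩|b⟩ ↦ |x⟩|b + f(x) mod Q⟩`; in particular `|x⟩|0⟩ ↦ |x⟩|f(x)⟩`
whenever `f` takes values below `Q`. -/
def oracle (L : ℕ) (f : ℕ → ℕ) : Matrix (Reg L × Reg L) (Reg L × Reg L) ℂ :=
  Matrix.of fun p s => if p = (s.1, s.2 + Fin.ofNat (2 ^ L) (f s.1)) then 1 else 0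

/-- `|0⟩|0⟩`. -/
def psi0 (L : ℕ) : State L := Pi.single (0, 0) 1

/-- The Fourier transform applied to the first register of `|0⟩|0⟩`. -/
def psi1 (L : ℕ) : State L :=
  (fourier L ⊗ₖ (1 : Matrix (Reg L) (Reg L) ℂ)) *ᵥ psi0 L

/-- The state after the application of `U_f`. -/
def psi2 (L : ℕ) (f : ℕ → ℕ) : State L := oracle L f *ᵥ psi1 L

/-- The state after the second Fourier transform of the first register. -/
def psi3 (L : ℕ) (f : ℕ → ℕ) : State L :=
  (fourier L ⊗ₖ (1 : Matrix (Reg L) (Reg L) ℂ)) *ᵥ psi2 L f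

/-- Born rule for the measurement of the first register: the outcome `y` has probability
`‖(|y⟩⟨y| ⊗ I) ψ₃‖²`. -/
def prob (L : ℕ) (f : ℕ → ℕ) (y : Reg L) : ℝ := ∑ b, ‖psi3 L f (y, b)‖ ^ 2

lemma prob_nonneg (L : ℕ) (f : ℕ → ℕ) (y : Reg L) : 0 ≤ prob L f y :=
  Finset.sum_nonneg fun _ _ => by positivity

lemma sum_norm_sq_mulVec {ι : Type*} [Fintype ι] [DecidableEq ι] (U : Matrix ι ι ℂ)
    (hU : Uᴴ * U = 1) (v : ι → ℂ) : ∑ i, ‖(U *ᵥ v) i‖ ^ 2 = ∑ i, ‖v i‖ ^ 2 := by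
  have key : ∀ w : ι → ℂ, ((∑ i, ‖w i‖ ^ 2 : ℝ) : ℂ) = star w ⬝ᵥ w := by
    intro w
    simp only [dotProduct, Pi.star_apply, RCLike.star_def, Complex.conj_mul']
    push_cast
    rfl
  have h : star (U *ᵥ v) ⬝ᵥ (U *ᵥ v) = star v ⬝ᵥ v := by
    rw [Matrix.star_mulVec, ← Matrix.dotProduct_mulVec, Matrix.mulVec_mulVec, hU,
      Matrix.one_mulVec]
  rw [← key, ← key] at h
  exact_mod_cast h

lemma omega_primitive (L : ℕ) : IsPrimitiveRoot (omega L) (2 ^ L) :=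
  Complex.isPrimitiveRoot_exp _ (by positivity)

lemma fourier_unitary (L : ℕ) : (fourier L)ᴴ * fourier L = 1 := by
  have hω := omega_primitive L
  have hn : ‖omega L‖ = 1 := hω.norm'_eq_one (by positivity)
  have hne : omega L ≠ 0 := hω.ne_zero (by positivity)
  have hconj : (starRingEnd ℂ) (omega L) = (omega L)⁻¹ := (Complex.inv_eq_conj hn).symm
  have hQ : (((2 ^ L : ℕ) : ℝ)) ≠ 0 := by positivity
  have hs : ((Real.sqrt ((2 ^ L : ℕ) : ℝ) : ℝ) : ℂ) * ((Real.sqrt ((2 ^ L : ℕ) : ℝ) : ℝ) : ℂ)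
      = ((2 ^ L : ℕ) : ℂ) := by
    rw [← Complex.ofReal_mul, Real.mul_self_sqrt (by positivity)]
    push_cast; rfl
  ext a b
  have hterm : ∀ y : Reg L, (fourier L)ᴴ a y * fourier L y b
      = ((2 ^ L : ℕ) : ℂ)⁻¹ * ((omega L ^ (a : ℕ))⁻¹ * omega L ^ (b : ℕ)) ^ (y : ℕ) := by
    intro y
    simp only [Matrix.conjTranspose_apply, fourier, Matrix.of_apply, star_mul', RCLike.star_def,
      map_pow, map_inv₀, Complex.conj_ofReal, hconj]
    rw [← hs, mul_pow, ← pow_mul, inv_pow, inv_pow, ← pow_mul, mul_inv]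
    ring
  rw [Matrix.mul_apply, Finset.sum_congr rfl fun y _ => hterm y, ← Finset.mul_sum,
    Fin.sum_univ_eq_sum_range (fun k => ((omega L ^ (a : ℕ))⁻¹ * omega L ^ (b : ℕ)) ^ k)]
  by_cases hab : a = b
  · subst hab
    rw [inv_mul_cancel₀ (pow_ne_zero _ hne)]
    simp
  · rw [Matrix.one_apply_ne hab]
    set z := (omega L ^ (a : ℕ))⁻¹ * omega L ^ (b : ℕ) with hz
    have hz1 : z ≠ 1 := by
      intro h
      have h2 : omega L ^ (a : ℕ) = omega L ^ (b : ℕ) := by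
        have := congrArg (fun t => omega L ^ (a : ℕ) * t) h
        simp only [hz, mul_one] at this
        rw [mul_inv_cancel_left₀ (pow_ne_zero _ hne)] at this
        exact this.symm
      exact hab (Fin.ext (hω.pow_inj a.2 b.2 h2))
    have hzQ : z ^ (2 ^ L) = 1 := by
      rw [hz, mul_pow, inv_pow, ← pow_mul, ← pow_mul, mul_comm (a : ℕ), mul_comm (b : ℕ),
        pow_mul, pow_mul, hω.pow_eq_one]
      simp
    rw [geom_sum_eq hz1, hzQ]
    simp

lemma fourier_kron_unitary (L : ℕ) :
    (fourier L ⊗ₖ (1 : Matrix (Reg L) (Reg L) ℂ))ᴴ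
      * (fourier L ⊗ₖ (1 : Matrix (Reg L) (Reg L) ℂ)) = 1 := by
  rw [Matrix.conjTranspose_kronecker, ← Matrix.mul_kronecker_mul, fourier_unitary]
  simp

lemma oracle_unitary (L : ℕ) (f : ℕ → ℕ) : (oracle L f)ᴴ * oracle L f = 1 := by
  ext ⟨x, b⟩ ⟨x', b'⟩
  simp only [Matrix.mul_apply, Matrix.conjTranspose_apply, oracle, Matrix.of_apply,
    apply_ite star, star_one, star_zero, ite_mul, one_mul, zero_mul, Finset.sum_ite_eq',
    Finset.mem_univ, if_true, Matrix.one_apply]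
  congr 1
  simp only [Prod.mk.injEq, eq_iff_iff]
  constructor
  · rintro ⟨rfl, h⟩
    exact ⟨rfl, add_right_cancel h⟩
  · rintro ⟨rfl, rfl⟩
    exact ⟨rfl, rfl⟩

lemma sum_prob (L : ℕ) (f : ℕ → ℕ) : ∑ y, prob L f y = 1 := by
  have h0 : ∑ p, ‖psi0 L p‖ ^ 2 = 1 := by
    rw [Finset.sum_eq_single (0, 0)]
    · simp [psi0]
    · intro p _ hp
      simp [psi0, Pi.single_eq_of_ne hp]
    · simp
  unfold prob
  rw [← Fintype.sum_prod_type' (fun y b => ‖psi3 L f (y, b)‖ ^ 2)]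
  unfold psi3 psi2 psi1
  rw [sum_norm_sq_mulVec _ (fourier_kron_unitary L), sum_norm_sq_mulVec _ (oracle_unitary L f),
    sum_norm_sq_mulVec _ (fourier_kron_unitary L), h0]

/-- The stochastic source: the distribution of the measured outcome `y ∈ S_Q`. -/
def source (L : ℕ) (f : ℕ → ℕ) : PMF (Reg L) :=
  PMF.ofFintype (fun y => ENNReal.ofReal (prob L f y)) (by
    rw [← ENNReal.ofReal_sum_of_nonneg fun y _ => prob_nonneg L f y, sum_prob, ENNReal.ofReal_one])

/-- The function `a ↦ m ^ a mod N`. -/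
def modExp (N m : ℕ) (a : ℕ) : ℕ := m ^ a % N

/-- The residue of `a` modulo `Q` in the interval `(-Q/2, Q/2]`. -/
def residue (Q : ℕ) (a : ℤ) : ℤ := a - Q * ⌈(a : ℚ) / Q - 1 / 2⌉

/-- `Y = {y ∈ S_Q : |{Py}_Q| ≤ P/2}`. -/
def Y (L P : ℕ) : Set (Reg L) :=
  {y | |((residue (2 ^ L) ((P : ℤ) * ((y : ℕ) : ℤ)) : ℤ) : ℚ)| ≤ (P : ℚ) / 2}

/-- `d(y) = round (P y / Q)`. -/
def d (L P : ℕ) (y : Reg L) : ℤ := round ((P : ℚ) / ((2 ^ L : ℕ) : ℚ) * ((y : ℕ) : ℚ))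

/-- The event `{y ∈ Y : gcd(d(y), P) = 1}`. -/
def good (L P : ℕ) : Set (Reg L) := {y | y ∈ Y L P ∧ Int.gcd (d L P y) P = 1}

/-- `N` is an odd composite number, `m` is prime to `N`, and `Q = 2 ^ L` satisfies
`N² ≤ Q < 2N²`. -/
structure Setup (N m L : ℕ) : Prop where
  odd : Odd N
  one_lt : 1 < N
  not_prime : ¬ N.Prime
  coprime : Nat.Coprime m N
  le_Q : N ^ 2 ≤ 2 ^ L
  Q_lt : 2 ^ L < 2 * N ^ 2

/-- The period of `a ↦ m ^ a mod N`: the multiplicative order of `m` modulo `N`. -/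
def period (N m : ℕ) : ℕ := orderOf (m : ZMod N)

/-- Probability that one run yields an outcome in `{y ∈ Y : gcd(d(y), P) = 1}`. -/
def goodProb (N m L : ℕ) : ℝ :=
  (source L (modExp N m)).toMeasure.real (good L (period N m))

/-- Probability that at least one of `k` independent runs yields an outcome in
`{y ∈ Y : gcd(d(y), P) = 1}`. -/
def successProb (N m L k : ℕ) : ℝ :=
  (MeasureTheory.Measure.pi fun _ : Fin k => (source L (modExp N m)).toMeasure).real
    {ys | ∃ i, ys i ∈ good L (period N m)}

/-- `lg lg N`, with `lg` the logarithm to base `2`. -/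
def lglg (N : ℕ) : ℝ := Real.logb 2 (Real.logb 2 N)

end Shor

end

/-!
Let `P` be the period. Before the second transform the amplitudes are constant on each residue
class modulo `P`, so the amplitude of an outcome `y` within `1 / 2` of `e Q / P` is, for each class,
a geometric sum of about `Q / P` terms turning through about half a circle at most. Summed
over the `P` classes this gives `y` a probability of at least `4 / (π² P) (1 - P / Q) ^ 2`. Such a
`y` lies in `Y` and has `d(y) = e`, so the `φ(P)` residues `e` prime to `P` contribute
`4 / π² * φ(P) / P * (1 - P / Q) ^ 2`.

The lower bound `φ(P) / P ≥ (e ^ (-γ) - o(1)) / log log P` follows from the third theorem of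
Mertens, since the primes `p > log P` dividing `P` are too few to matter. In that theorem, partial
summation from `∑ Λ n / n = log x + O(1)` yields `∑ Λ n / (n log n) = log log x + C + o(1)`. To
identify `C` with `γ`, compare the exponential series
`log ζ (1 + t) = ∑ Λ n / (n log n) e ^ (-t log n)` with `-log (1 - e ^ (-t)) = ∑ e ^ (-t n) / n`:
their difference tends to `0` as `t → 0+`, while the difference of their coefficient sums tends to
`C - γ`.
-/

namespace Mertens

open Filter Topology Finset ArithmeticFunction MeasureTheory

/-! ### The third theorem of Mertens -/

lemma log_factorial_eq_sum_vonMangoldt_mul_div (n : ℕ) :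
    Real.log n.factorial = ∑ k ∈ Ioc 0 n, Λ k * (n / k : ℕ) := by
  rw [← sum_Ioc_mul_zeta_eq_sum, vonMangoldt_mul_zeta]
  simp only [log_apply]
  induction n with
  | zero => simp
  | succ n ih =>
    rw [Nat.factorial_succ, Nat.cast_mul, Real.log_mul (by positivity) (by positivity), ih,
      sum_Ioc_succ_top n.zero_le, add_comm]

lemma log_sub_one_le_sum_vonMangoldt_div {n : ℕ} (hn : 0 < n) :
    Real.log n - 1 ≤ ∑ k ∈ Ioc 0 n, Λ k / k := by
  have hn' : (0 : ℝ) < n := by exact_mod_cast hn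
  have hstirling : n * Real.log n - n ≤ Real.log n.factorial := by
    have := Stirling.le_log_factorial_stirling hn.ne'
    have := Real.log_natCast_nonneg n
    have := Real.log_nonneg (by linarith [Real.pi_gt_three] : 1 ≤ 2 * Real.pi)
    linarith
  refine le_of_mul_le_mul_left ?_ hn'
  calc n * (Real.log n - 1) ≤ Real.log n.factorial := by linarith
    _ = ∑ k ∈ Ioc 0 n, Λ k * (n / k : ℕ) := log_factorial_eq_sum_vonMangoldt_mul_div n
    _ ≤ ∑ k ∈ Ioc 0 n, Λ k * (n / k) :=
        sum_le_sum fun k _ => mul_le_mul_of_nonneg_left Nat.cast_div_le vonMangoldt_nonneg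
    _ = n * ∑ k ∈ Ioc 0 n, Λ k / k := by
        rw [mul_sum]
        exact sum_congr rfl fun k _ => by ring

lemma sum_vonMangoldt_div_le_log_add (n : ℕ) :
    ∑ k ∈ Ioc 0 n, Λ k / k ≤ Real.log n + (Real.log 4 + 4) := by
  rcases n.eq_zero_or_pos with rfl | hn
  · have := Real.log_nonneg (by norm_num : (1 : ℝ) ≤ 4)
    simpa using by linarith
  have hn' : (0 : ℝ) < n := by exact_mod_cast hn
  have hpsi := Chebyshev.psi_le_const_mul_self hn'.le
  rw [Chebyshev.psi, Nat.floor_natCast] at hpsi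
  have hfac : Real.log n.factorial ≤ n * Real.log n := by
    rw [← Real.log_pow]
    exact Real.log_le_log (by positivity) (by exact_mod_cast n.factorial_le_pow)
  refine le_of_mul_le_mul_left ?_ hn'
  calc n * ∑ k ∈ Ioc 0 n, Λ k / k = ∑ k ∈ Ioc 0 n, Λ k * (n / k) := by
        rw [mul_sum]
        exact sum_congr rfl fun k _ => by ring
    _ ≤ ∑ k ∈ Ioc 0 n, Λ k * ((n / k : ℕ) + 1) := by
        refine sum_le_sum fun k _ => mul_le_mul_of_nonneg_left ?_ vonMangoldt_nonneg
        rw [← Nat.floor_div_eq_div (K := ℝ)]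
        exact (Nat.lt_floor_add_one _).le
    _ = Real.log n.factorial + ∑ k ∈ Ioc 0 n, Λ k := by
        simp only [mul_add, mul_one, sum_add_distrib, log_factorial_eq_sum_vonMangoldt_mul_div]
    _ ≤ n * (Real.log n + (Real.log 4 + 4)) := by linarith

theorem abs_sum_vonMangoldt_div_sub_log_le (n : ℕ) :
    |∑ k ∈ Ioc 0 n, Λ k / k - Real.log n| ≤ Real.log 4 + 4 := by
  have := Real.log_nonneg (by norm_num : (1 : ℝ) ≤ 4)
  rcases n.eq_zero_or_pos with rfl | hn
  · simpa using by linarith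
  · rw [abs_le]
    constructor <;> linarith [log_sub_one_le_sum_vonMangoldt_div hn,
      sum_vonMangoldt_div_le_log_add n]

section PartialSummation

variable {a b : ℝ}

lemma div_le_log_sub_log (ha : 0 < a) (hb : 0 < b) : (b - a) / b ≤ Real.log b - Real.log a := by
  have h := Real.one_sub_inv_le_log_of_pos (div_pos hb ha)
  rwa [Real.log_div hb.ne' ha.ne', inv_div, one_sub_div hb.ne'] at h

lemma log_sub_log_le_div (ha : 0 < a) (hb : 0 < b) : Real.log b - Real.log a ≤ (b - a) / a := by
  have h := Real.log_le_sub_one_of_pos (div_pos hb ha)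
  rwa [Real.log_div hb.ne' ha.ne', div_sub_one ha.ne'] at h

lemma summable_log_sub_log_sub_div {b : ℕ → ℝ} {M : ℝ} (hpos : ∀ n, 0 < b n) (hmono : Monotone b)
    (hM : ∀ n, b (n + 1) - b n ≤ M) :
    Summable fun n => Real.log (b (n + 1)) - Real.log (b n) - (b (n + 1) - b n) / b (n + 1) := by
  have hM₀ : 0 ≤ M := (sub_nonneg.2 (hmono (Nat.le_succ 0))).trans (hM 0)
  have hterm : ∀ n, Real.log (b (n + 1)) - Real.log (b n) - (b (n + 1) - b n) / b (n + 1)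
      ≤ M * ((b n)⁻¹ - (b (n + 1))⁻¹) := fun n => by
    have hinv : (b (n + 1))⁻¹ ≤ (b n)⁻¹ := inv_anti₀ (hpos n) (hmono n.le_succ)
    calc _ ≤ (b (n + 1) - b n) / b n - (b (n + 1) - b n) / b (n + 1) :=
          sub_le_sub_right (log_sub_log_le_div (hpos n) (hpos (n + 1))) _
      _ = (b (n + 1) - b n) * ((b n)⁻¹ - (b (n + 1))⁻¹) := by ring
      _ ≤ _ := mul_le_mul_of_nonneg_right (hM n) (sub_nonneg.2 hinv)
  refine summable_of_sum_range_le (c := M * (b 0)⁻¹)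
    (fun n => sub_nonneg.2 (div_le_log_sub_log (hpos n) (hpos (n + 1)))) fun n => ?_
  refine (sum_le_sum fun i _ => hterm i).trans ?_
  rw [← mul_sum, sum_range_sub']
  exact mul_le_mul_of_nonneg_left (sub_le_self _ (inv_nonneg.2 (hpos n).le)) hM₀

theorem exists_tendsto_sum_div_sub_log {b c : ℕ → ℝ} {M K : ℝ} (hpos : ∀ n, 0 < b n)
    (hmono : Monotone b) (hlim : Tendsto b atTop atTop) (hM : ∀ n, b (n + 1) - b n ≤ M)
    (hK : ∀ n, |∑ i ∈ range n, c i - b n| ≤ K) :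
    ∃ C, Tendsto (fun n => ∑ i ∈ range n, c i / b (i + 1) - Real.log (b n)) atTop (𝓝 C) := by
  have hbounded : ∀ n, ‖∑ i ∈ range n, (c i - (b (i + 1) - b i))‖ ≤ K + K := fun n => by
    have h₀ : |b 0| ≤ K := by simpa using hK 0
    rw [sum_sub_distrib, sum_range_sub, ← sub_add]
    exact (norm_add_le _ _).trans (add_le_add (hK n) h₀)
  have hanti : Antitone fun n => (b (n + 1))⁻¹ := fun m n h =>
    inv_anti₀ (hpos _) (hmono (Nat.succ_le_succ h))
  obtain ⟨U, hU⟩ := cauchySeq_tendsto_of_complete <|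
    hanti.cauchySeq_series_mul_of_tendsto_zero_of_bounded
      ((tendsto_add_atTop_iff_nat 1).2 hlim).inv_tendsto_atTop hbounded
  have hV := (summable_log_sub_log_sub_div hpos hmono hM).hasSum.tendsto_sum_nat
  refine ⟨_, ((hU.sub hV).sub_const (Real.log (b 0))).congr fun n => ?_⟩
  rw [← sum_sub_distrib, sub_eq_sub_iff_add_eq_add, ← sub_eq_iff_eq_add, add_sub_assoc,
    ← sum_range_sub (fun i => Real.log (b i)), ← sum_add_distrib]
  refine sum_congr rfl fun i _ => ?_
  rw [smul_eq_mul]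
  ring

end PartialSummation

/-- The coefficients `Λ n / (n log n)` of the logarithm of the zeta function at `1`; the value is
`1 / (k p ^ k)` at a prime power `n = p ^ k` and `0` elsewhere. -/
noncomputable def logZetaCoeff (n : ℕ) : ℝ := Λ n / (n * Real.log n)

lemma logZetaCoeff_nonneg (n : ℕ) : 0 ≤ logZetaCoeff n :=
  div_nonneg vonMangoldt_nonneg (mul_nonneg n.cast_nonneg (Real.log_natCast_nonneg n))

theorem exists_tendsto_sum_logZetaCoeff_sub_log_log :
    ∃ C : ℝ, Tendsto (fun n : ℕ => ∑ k ∈ Ioc 0 n, logZetaCoeff k - Real.log (Real.log n))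
      atTop (𝓝 C) := by
  have hsplit (g : ℕ → ℝ) (n : ℕ) :
      ∑ k ∈ Ioc 0 (n + 2), g k = ∑ k ∈ Ioc 0 2, g k + ∑ i ∈ range n, g (i + 3) := by
    induction n with
    | zero => simp
    | succ n ih =>
      rw [show n + 1 + 2 = n + 2 + 1 by ring, sum_Ioc_succ_top (by omega), ih, sum_range_succ]
      ring
  have hlt (n : ℕ) : (1 : ℝ) < (n + 2 : ℕ) := by exact_mod_cast (by omega : 1 < n + 2)
  obtain ⟨C, hC⟩ := exists_tendsto_sum_div_sub_log (b := fun n => Real.log (n + 2 : ℕ))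
    (c := fun i => Λ (i + 3) / (i + 3 : ℕ)) (M := 1)
    (K := Real.log 4 + 4 + |∑ k ∈ Ioc 0 2, Λ k / k|)
    (fun n => Real.log_pos (hlt n))
    (fun m n h => Real.log_le_log (by positivity) (by exact_mod_cast Nat.add_le_add_right h 2))
    (Real.tendsto_log_atTop.comp
      (tendsto_natCast_atTop_atTop.comp (tendsto_add_atTop_nat 2)))
    (fun n => by
      refine (log_sub_log_le_div (by positivity) (by positivity)).trans ?_
      rw [div_le_one (by positivity)]
      push_cast
      linarith)
    (fun n => by
      have h := abs_sum_vonMangoldt_div_sub_log_le (n + 2)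
      rw [hsplit, add_sub_assoc] at h
      rw [← add_sub_cancel_left (∑ k ∈ Ioc 0 2, Λ k / (k : ℝ)) (_ - _)]
      exact (abs_sub _ _).trans (add_le_add_left h _))
  refine ⟨∑ k ∈ Ioc 0 2, logZetaCoeff k + C,
    (tendsto_add_atTop_iff_nat 2).1 ((hC.const_add _).congr fun n => ?_)⟩
  rw [hsplit _ n, add_sub_assoc]
  simp only [logZetaCoeff, div_div, add_right_comm _ 1 2]

section Laplace

lemma integrableOn_indicator_Ici_exp_neg (a c : ℝ) :
    IntegrableOn ((Set.Ici c).indicator fun v => a * Real.exp (-v)) (Set.Ioi 0) :=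
  Integrable.indicator ((integrableOn_exp_neg_Ioi 0).const_mul a) measurableSet_Ici

lemma setIntegral_indicator_Ici_exp_neg (a : ℝ) {c : ℝ} (hc : 0 ≤ c) :
    ∫ v in Set.Ioi 0, (Set.Ici c).indicator (fun v => a * Real.exp (-v)) v = a * Real.exp (-c) := by
  rw [← integral_Ici_eq_integral_Ioi, integral_indicator measurableSet_Ici,
    Measure.restrict_restrict measurableSet_Ici, Set.Ici_inter_Ici, sup_eq_left.2 hc,
    integral_Ici_eq_integral_Ioi, integral_const_mul, integral_exp_neg_Ioi]

theorem hasSum_mul_exp_neg {ι : Type*} [Countable ι] {a l : ι → ℝ} (hl : ∀ i, 0 ≤ l i)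
    (hs : Summable fun i => a i * Real.exp (-l i)) :
    HasSum (fun i => a i * Real.exp (-l i))
      (∫ v in Set.Ioi 0, ∑' i, (Set.Ici (l i)).indicator (fun v => a i * Real.exp (-v)) v) := by
  have h := hasSum_integral_of_summable_integral_norm (μ := volume.restrict (Set.Ioi 0))
    (F := fun i => (Set.Ici (l i)).indicator fun v => a i * Real.exp (-v))
    (fun i => integrableOn_indicator_Ici_exp_neg (a i) (l i)) ?_
  · exact h.congr_fun fun i => (setIntegral_indicator_Ici_exp_neg (a i) (hl i)).symm
  · refine hs.norm.congr fun i => ?_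
    simp only [norm_indicator_eq_indicator_norm, norm_mul, Real.norm_of_nonneg (Real.exp_nonneg _),
      setIntegral_indicator_Ici_exp_neg _ (hl i)]

lemma hasSum_indicator_Ici {a l : ℕ → ℝ} {N : ℕ} {v : ℝ} (ha : a 0 = 0)
    (hN : ∀ n ≠ 0, l n ≤ v ↔ n ≤ N) (f : ℝ → ℝ) :
    HasSum (fun n => (Set.Ici (l n)).indicator (fun v => a n * f v) v)
      ((∑ n ∈ Ioc 0 N, a n) * f v) := by
  have hterm : ∀ n, (Set.Ici (l n)).indicator (fun v => a n * f v) v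
      = if n ∈ Ioc 0 N then a n * f v else 0 := fun n => by
    rcases eq_or_ne n 0 with rfl | hn
    · simp [Set.indicator, ha]
    · simp [Set.indicator, hN n hn, Nat.pos_of_ne_zero hn]
  rw [sum_mul, ← sum_congr rfl fun n hn => (hterm n).trans (if_pos hn)]
  exact hasSum_sum_of_ne_finset_zero fun n hn => (hterm n).trans (if_neg hn)

end Laplace

/-- The difference of the partial sums `∑_{n ≤ e^u} Λ n / (n log n)` and `∑_{n ≤ u} 1 / n`. These
collect the coefficients of the terms with exponent at most `u` in the exponential series
`log ζ (1 + t) = ∑ Λ n / (n log n) * e ^ (-t log n)` and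
`-log (1 - e ^ (-t)) = ∑ e ^ (-t n) / n`. -/
noncomputable def partialDiff (u : ℝ) : ℝ :=
  ∑ n ∈ Ioc 0 ⌊Real.exp u⌋₊, logZetaCoeff n - harmonic ⌊u⌋₊

lemma measurable_partialDiff : Measurable partialDiff :=
  ((measurable_from_nat (f := fun k => ∑ n ∈ Ioc 0 k, logZetaCoeff n)).comp
      (Nat.measurable_floor.comp Real.measurable_exp)).sub
    ((measurable_from_nat (f := fun k => (harmonic k : ℝ))).comp Nat.measurable_floor)

lemma logZetaCoeff_mul_exp (t : ℝ) (n : ℕ) :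
    logZetaCoeff n * Real.exp (-(t * Real.log n)) = Λ n / ((n : ℝ) ^ (1 + t) * Real.log n) := by
  rcases n.eq_zero_or_pos with rfl | hn
  · simp [logZetaCoeff]
  have hn' : (0 : ℝ) < n := by exact_mod_cast hn
  rw [logZetaCoeff, Real.rpow_add hn', Real.rpow_one, Real.rpow_def_of_pos hn', Real.exp_neg,
    mul_comm t]
  field_simp

lemma summable_logZetaCoeff_mul_exp {t : ℝ} (ht : 0 < t) :
    Summable fun n : ℕ => logZetaCoeff n * Real.exp (-(t * Real.log n)) := by
  refine Summable.of_nonneg_of_le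
    (fun n => mul_nonneg (logZetaCoeff_nonneg n) (Real.exp_nonneg _)) (fun n => ?_)
    (Real.summable_one_div_nat_rpow.2 (by linarith : 1 < 1 + t))
  rw [logZetaCoeff_mul_exp, mul_comm, ← div_div]
  exact div_le_div_of_nonneg_right
    (div_le_one_of_le₀ vonMangoldt_le_log (Real.log_natCast_nonneg n)) (by positivity)

lemma hasSum_logZetaCoeff_mul_exp {t : ℝ} (ht : 0 < t) :
    HasSum (fun n : ℕ => logZetaCoeff n * Real.exp (-(t * Real.log n)))
      (Real.log (riemannZeta ((1 + t : ℝ) : ℂ)).re) := by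
  rw [log_riemannZeta_eq (by linarith : 1 < 1 + t)]
  simpa only [logZetaCoeff_mul_exp] using (summable_logZetaCoeff_mul_exp ht).hasSum

lemma hasSum_inv_mul_exp {t : ℝ} (ht : 0 < t) :
    HasSum (fun n : ℕ => (n : ℝ)⁻¹ * Real.exp (-(t * n))) (-Real.log (1 - Real.exp (-t))) := by
  rw [← hasSum_nat_add_iff' 1]
  refine (sum_range_one (fun n : ℕ => (n : ℝ)⁻¹ * Real.exp (-(t * n))) ▸ ?_)
  simp only [Nat.cast_zero, inv_zero, zero_mul, sub_zero]
  refine (Real.hasSum_pow_div_log_of_abs_lt_one (x := Real.exp (-t)) ?_).congr_fun fun n => ?_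
  · rw [abs_of_pos (Real.exp_pos _)]
    exact Real.exp_lt_one_iff.2 (neg_neg_of_pos ht)
  · rw [← Real.exp_nat_mul, div_eq_inv_mul]
    push_cast
    ring_nf

theorem integral_partialDiff {t : ℝ} (ht : 0 < t) :
    ∫ v in Set.Ioi 0, partialDiff (v / t) * Real.exp (-v)
      = Real.log (riemannZeta ((1 + t : ℝ) : ℂ)).re + Real.log (1 - Real.exp (-t)) := by
  set a : ℕ ⊕ ℕ → ℝ := Sum.elim logZetaCoeff fun n => -(n : ℝ)⁻¹ with ha
  set l : ℕ ⊕ ℕ → ℝ := Sum.elim (fun n => t * Real.log n) fun n => t * n with hl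
  have hseries : HasSum (fun i => a i * Real.exp (-l i))
      (Real.log (riemannZeta ((1 + t : ℝ) : ℂ)).re + Real.log (1 - Real.exp (-t))) := by
    refine (hasSum_logZetaCoeff_mul_exp ht).sum ?_
    simpa only [Function.comp_def, ha, hl, Sum.elim_inr, neg_mul, neg_neg]
      using (hasSum_inv_mul_exp ht).neg
  have hl₀ : ∀ i, 0 ≤ l i := Sum.rec
    (fun n => mul_nonneg ht.le (Real.log_natCast_nonneg n)) fun n => mul_nonneg ht.le n.cast_nonneg
  rw [hseries.unique (hasSum_mul_exp_neg hl₀ hseries.summable)]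
  refine setIntegral_congr_fun measurableSet_Ioi fun v hv => ?_
  have hzeta := hasSum_indicator_Ici (a := logZetaCoeff) (l := fun n => t * Real.log n)
    (N := ⌊Real.exp (v / t)⌋₊) (v := v) (by simp [logZetaCoeff])
    (fun n hn => by rw [Nat.le_floor_iff (Real.exp_nonneg _),
      ← Real.log_le_iff_le_exp (by positivity), le_div_iff₀' ht]) fun v => Real.exp (-v)
  have hharmonic := hasSum_indicator_Ici (a := fun n => -(n : ℝ)⁻¹) (l := fun n => t * n)
    (N := ⌊v / t⌋₊) (v := v) (by simp)
    (fun n _ => by rw [Nat.le_floor_iff (div_pos hv ht).le, le_div_iff₀' ht])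
    fun v => Real.exp (-v)
  refine Eq.trans ?_ (hzeta.sum (f := fun i => (Set.Ici (l i)).indicator
    (fun v => a i * Real.exp (-v)) v) hharmonic).tsum_eq.symm
  rw [partialDiff, harmonic_eq_sum_Icc, ← add_mul, sum_neg_distrib, ← sub_eq_add_neg]
  push_cast
  rfl

theorem tendsto_log_zeta_add_log_one_sub_exp_neg :
    Tendsto (fun t : ℝ => Real.log (riemannZeta ((1 + t : ℝ) : ℂ)).re
      + Real.log (1 - Real.exp (-t))) (𝓝[>] 0) (𝓝 0) := by
  have hslope : Tendsto (fun t : ℝ => (1 - Real.exp (-t)) / t) (𝓝[>] 0) (𝓝 1) := by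
    have hderiv : HasDerivAt (fun t : ℝ => 1 - Real.exp (-t)) 1 0 := by
      simpa using ((hasDerivAt_neg (0 : ℝ)).exp).const_sub 1
    simpa [slope_fun_def_field] using hderiv.tendsto_slope.mono_left (nhdsGT_le_nhdsNE 0)
  have hlog : Tendsto (fun t : ℝ => Real.log ((1 - Real.exp (-t)) / t)) (𝓝[>] 0) (𝓝 0) := by
    simpa using hslope.log one_ne_zero
  have hadd : Tendsto (fun t : ℝ => 1 + t) (𝓝[>] 0) (𝓝[>] 1) :=
    tendsto_nhdsWithin_of_tendsto_nhds_of_eventually_within _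
      (Continuous.tendsto' (by fun_prop) _ _ (add_zero 1) |>.mono_left nhdsWithin_le_nhds)
      (eventually_nhdsWithin_of_forall fun t (ht : 0 < t) => lt_add_of_pos_right 1 ht)
  have hzeta := ((Asymptotics.isLittleO_one_iff ℝ).1
    log_riemannZeta_add_log_sub_isLittleO_ofReal).comp hadd
  refine ((hzeta.add hlog).congr' ?_).trans (by rw [add_zero])
  filter_upwards [self_mem_nhdsWithin] with t (ht : 0 < t)
  have hexp : 0 < 1 - Real.exp (-t) := sub_pos.2 (Real.exp_lt_one_iff.2 (neg_neg_of_pos ht))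
  rw [Function.comp_apply, Real.log_div hexp.ne' ht.ne', add_sub_cancel_left]
  ring

section Limits

variable {α : Type*} {l : Filter α} {f g : α → ℝ}

lemma tendsto_log_sub_log_of_tendsto_div (hf : ∀ᶠ x in l, f x ≠ 0) (hg : ∀ᶠ x in l, g x ≠ 0)
    (h : Tendsto (fun x => f x / g x) l (𝓝 1)) :
    Tendsto (fun x => Real.log (f x) - Real.log (g x)) l (𝓝 0) := by
  have hlog := h.log one_ne_zero
  rw [Real.log_one] at hlog
  refine hlog.congr' ?_
  filter_upwards [hf, hg] with x hfx hgx using Real.log_div hfx hgx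

lemma tendsto_log_natFloor_sub_log :
    Tendsto (fun x : ℝ => Real.log ⌊x⌋₊ - Real.log x) atTop (𝓝 0) :=
  tendsto_log_sub_log_of_tendsto_div
    ((tendsto_natCast_atTop_atTop.comp tendsto_nat_floor_atTop).eventually_ne_atTop 0)
    (eventually_ne_atTop 0) tendsto_nat_floor_div_atTop

lemma tendsto_log_log_natFloor_exp_sub_log :
    Tendsto (fun u : ℝ => Real.log (Real.log ⌊Real.exp u⌋₊) - Real.log u) atTop (𝓝 0) := by
  have hsub : Tendsto (fun u : ℝ => Real.log ⌊Real.exp u⌋₊ - u) atTop (𝓝 0) := by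
    simpa [Function.comp_def] using tendsto_log_natFloor_sub_log.comp Real.tendsto_exp_atTop
  have hfloor : Tendsto (fun u : ℝ => Real.log ⌊Real.exp u⌋₊) atTop atTop :=
    Real.tendsto_log_atTop.comp (tendsto_natCast_atTop_atTop.comp
      (tendsto_nat_floor_atTop.comp Real.tendsto_exp_atTop))
  refine tendsto_log_sub_log_of_tendsto_div (hfloor.eventually_ne_atTop 0)
    (eventually_ne_atTop 0) ?_
  refine ((hsub.div_atTop tendsto_id).add_const 1).congr' ?_ |>.trans (by rw [zero_add])
  filter_upwards [eventually_ne_atTop 0] with u hu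
  rw [id, sub_div, div_self hu, sub_add_cancel]

lemma exists_forall_abs_sub_le {f g : ℝ → ℝ} {c : ℝ} (hf : Monotone f) (hg : Monotone g)
    (hf₀ : ∀ u, 0 ≤ f u) (hg₀ : ∀ u, 0 ≤ g u) (h : Tendsto (fun u => f u - g u) atTop (𝓝 c)) :
    ∃ K, ∀ u, |f u - g u| ≤ K := by
  obtain ⟨U, hU⟩ := eventually_atTop.1 (h.abs.eventually (gt_mem_nhds (lt_add_one |c|)))
  refine ⟨max (|c| + 1) (f U + g U), fun u => ?_⟩
  rcases le_total U u with hu | hu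
  · exact le_max_of_le_left (hU u hu).le
  · refine le_max_of_le_right (abs_le.2 ⟨?_, ?_⟩) <;>
      linarith [hf hu, hg hu, hf₀ u, hg₀ u]

-- The final value theorem for the Laplace transform `t * ∫ D v * e ^ (-t v)`, rescaled by `t`.
theorem tendsto_integral_comp_div_mul_exp_neg {D : ℝ → ℝ} {K c : ℝ} (hD : Measurable D)
    (hK : ∀ u, |D u| ≤ K) (h : Tendsto D atTop (𝓝 c)) :
    Tendsto (fun t : ℝ => ∫ v in Set.Ioi 0, D (v / t) * Real.exp (-v)) (𝓝[>] 0) (𝓝 c) := by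
  have hc : ∫ v in Set.Ioi (0 : ℝ), c * Real.exp (-v) = c := by
    rw [integral_const_mul, integral_exp_neg_Ioi_zero, mul_one]
  rw [← hc]
  refine tendsto_integral_filter_of_dominated_convergence (fun v => K * Real.exp (-v))
    (.of_forall fun t => ?_) (.of_forall fun t => .of_forall fun v => ?_)
    ((integrableOn_exp_neg_Ioi 0).const_mul K) ?_
  · exact ((hD.comp (measurable_id.div_const t)).mul
      (Real.measurable_exp.comp measurable_neg)).aestronglyMeasurable
  · rw [norm_mul, Real.norm_eq_abs, Real.norm_of_nonneg (Real.exp_nonneg _)]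
    exact mul_le_mul_of_nonneg_right (hK _) (Real.exp_nonneg _)
  · refine (ae_restrict_mem measurableSet_Ioi).mono fun v (hv : 0 < v) => ?_
    exact (h.comp (tendsto_inv_nhdsGT_zero.const_mul_atTop hv)).mul_const _

end Limits

lemma tendsto_partialDiff {C : ℝ}
    (hC : Tendsto (fun n : ℕ => ∑ k ∈ Ioc 0 n, logZetaCoeff k - Real.log (Real.log n))
      atTop (𝓝 C)) :
    Tendsto partialDiff atTop (𝓝 (C - Real.eulerMascheroniConstant)) := by
  have hzeta := (hC.comp (tendsto_nat_floor_atTop.comp Real.tendsto_exp_atTop)).add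
    tendsto_log_log_natFloor_exp_sub_log
  have hharmonic := (Real.tendsto_harmonic_sub_log.comp tendsto_nat_floor_atTop).add
    tendsto_log_natFloor_sub_log
  have h := hzeta.sub hharmonic
  simp only [add_zero] at h
  refine h.congr fun u => ?_
  simp only [Function.comp_apply, partialDiff]
  ring

lemma exists_forall_abs_partialDiff_le {c : ℝ} (h : Tendsto partialDiff atTop (𝓝 c)) :
    ∃ K, ∀ u, |partialDiff u| ≤ K := by
  have hsum {a : ℕ → ℝ} (ha : ∀ n, 0 ≤ a n) : Monotone fun n => ∑ k ∈ Ioc 0 n, a k :=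
    fun m n hmn => sum_le_sum_of_subset_of_nonneg (Ioc_subset_Ioc_right hmn) fun k _ _ => ha k
  have hharmonic : Monotone fun n : ℕ => (harmonic n : ℝ) := by
    have hcast (n : ℕ) : (harmonic n : ℝ) = ∑ k ∈ Ioc 0 n, (k : ℝ)⁻¹ := by
      rw [harmonic_eq_sum_Icc]
      push_cast
      rfl
    simpa only [hcast] using hsum fun n => inv_nonneg.2 n.cast_nonneg
  exact exists_forall_abs_sub_le
    ((hsum logZetaCoeff_nonneg).comp (Nat.floor_mono.comp Real.exp_monotone))
    (hharmonic.comp Nat.floor_mono) (fun u => sum_nonneg fun k _ => logZetaCoeff_nonneg k)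
    (fun u => by simpa using hharmonic (Nat.zero_le ⌊u⌋₊)) h

theorem tendsto_sum_logZetaCoeff_sub_log_log :
    Tendsto (fun n : ℕ => ∑ k ∈ Ioc 0 n, logZetaCoeff k - Real.log (Real.log n)) atTop
      (𝓝 Real.eulerMascheroniConstant) := by
  obtain ⟨C, hC⟩ := exists_tendsto_sum_logZetaCoeff_sub_log_log
  have hlim := tendsto_partialDiff hC
  obtain ⟨K, hK⟩ := exists_forall_abs_partialDiff_le hlim
  have habel := tendsto_integral_comp_div_mul_exp_neg measurable_partialDiff hK hlim
  have hzero : Tendsto (fun t : ℝ => ∫ v in Set.Ioi 0, partialDiff (v / t) * Real.exp (-v))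
      (𝓝[>] 0) (𝓝 0) :=
    tendsto_log_zeta_add_log_one_sub_exp_neg.congr'
      (eventually_nhdsWithin_of_forall fun _ ht => (integral_partialDiff ht).symm)
  rwa [sub_eq_zero.1 (tendsto_nhds_unique habel hzero)] at hC

/-- The contribution `-log (1 - 1 / p) - 1 / p` of the proper powers of a prime `p` to
`∑ 1 / (k p ^ k)`. -/
noncomputable def properPowerSum (p : ℕ) : ℝ := -Real.log (1 - (p : ℝ)⁻¹) - (p : ℝ)⁻¹

lemma logZetaCoeff_prime_pow {p : ℕ} (hp : p.Prime) {k : ℕ} (hk : k ≠ 0) :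
    logZetaCoeff (p ^ k) = (p : ℝ)⁻¹ ^ k / k := by
  have hlog : Real.log p ≠ 0 := (Real.log_pos (by exact_mod_cast hp.one_lt)).ne'
  rw [logZetaCoeff, vonMangoldt_apply_pow hk, vonMangoldt_apply_prime hp, Nat.cast_pow,
    Real.log_pow, inv_pow]
  field_simp

lemma logZetaCoeff_eq_zero {n : ℕ} (hn : ¬IsPrimePow n) : logZetaCoeff n = 0 := by
  rw [logZetaCoeff, vonMangoldt_eq_zero_iff.2 hn, zero_div]

lemma hasSum_indicator_not_prime_logZetaCoeff_pow {p : ℕ} (hp : p.Prime) :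
    HasSum (fun k => {n : ℕ | ¬n.Prime}.indicator logZetaCoeff (p ^ (k + 1)))
      (properPowerSum p) := by
  have hlog := Real.hasSum_pow_div_log_of_abs_lt_one (x := (p : ℝ)⁻¹) (by
    rw [abs_of_nonneg (by positivity)]
    exact inv_lt_one_of_one_lt₀ (by exact_mod_cast hp.one_lt))
  rw [← hasSum_nat_add_iff' 1] at hlog ⊢
  simp only [sum_range_one, zero_add, pow_one, Nat.cast_zero, div_one] at hlog ⊢
  rw [Set.indicator_of_notMem (by simpa using hp), sub_zero]
  refine hlog.congr_fun fun k => ?_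
  have hpow : ¬(p ^ (k + 1 + 1)).Prime := Nat.Prime.not_prime_pow (by omega)
  rw [Set.indicator_of_mem (by exact hpow), logZetaCoeff_prime_pow hp (by omega)]
  push_cast
  rfl

lemma properPowerSum_nonneg {p : ℕ} (hp : p.Prime) : 0 ≤ properPowerSum p :=
  (hasSum_indicator_not_prime_logZetaCoeff_pow hp).nonneg fun _ =>
    Set.indicator_nonneg (fun n _ => logZetaCoeff_nonneg n) _

lemma properPowerSum_le {p : ℕ} (hp : p.Prime) : properPowerSum p ≤ 2 * (1 / (p : ℝ) ^ 2) := by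
  have hp' : (2 : ℝ) ≤ p := by exact_mod_cast hp.two_le
  have hlog := Real.one_sub_inv_le_log_of_pos (x := 1 - (p : ℝ)⁻¹)
    (sub_pos.2 (inv_lt_one_of_one_lt₀ (by linarith)))
  have hne : (p : ℝ) - 1 ≠ 0 := by linarith
  calc properPowerSum p ≤ (1 - (p : ℝ)⁻¹)⁻¹ - 1 - (p : ℝ)⁻¹ := by
        rw [properPowerSum]
        linarith
    _ = 1 / (p * (p - 1)) := by
        field_simp
        ring
    _ ≤ 2 * (1 / (p : ℝ) ^ 2) := by
        rw [mul_one_div, div_le_div_iff₀ (by nlinarith) (by positivity)]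
        nlinarith

lemma summable_properPowerSum : Summable fun p : Nat.Primes => properPowerSum p :=
  Summable.of_nonneg_of_le (fun p => properPowerSum_nonneg p.2) (fun p => properPowerSum_le p.2)
    (((Real.summable_one_div_nat_pow.2 one_lt_two).mul_left 2).comp_injective
      (i := fun p : Nat.Primes => (p : ℕ)) Subtype.coe_injective)

theorem hasSum_of_forall_hasSum_prime_pow {f : ℕ → ℝ} {g : Nat.Primes → ℝ} (hf : ∀ n, 0 ≤ f n)
    (hf₀ : ∀ n, ¬IsPrimePow n → f n = 0)
    (hfg : ∀ p : Nat.Primes, HasSum (fun k => f ((p : ℕ) ^ (k + 1))) (g p))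
    (hg : Summable g) : HasSum f (∑' p, g p) := by
  have hsummable : Summable fun q : Nat.Primes × ℕ => f ((q.1 : ℕ) ^ (q.2 + 1)) := by
    rw [summable_prod_of_nonneg fun q => hf _]
    exact ⟨fun p => (hfg p).summable, by simpa only [(hfg _).tsum_eq] using hg⟩
  have hsum : HasSum (fun q : Nat.Primes × ℕ => f ((q.1 : ℕ) ^ (q.2 + 1))) (∑' p, g p) :=
    (hsummable.hasSum.prod_fiberwise hfg).tsum_eq ▸ hsummable.hasSum
  have hprimePow : HasSum (fun n : {n : ℕ // IsPrimePow n} => f n) (∑' p, g p) :=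
    Nat.Primes.prodNatEquiv.hasSum_iff.1 hsum
  exact (hasSum_subtype_iff_of_support_subset (s := {n | IsPrimePow n})
    fun n hn => not_not.1 fun h => hn (hf₀ n h)).1 hprimePow

lemma hasSum_indicator_prime_properPowerSum :
    HasSum ({n : ℕ | n.Prime}.indicator properPowerSum)
      (∑' p : Nat.Primes, properPowerSum p) :=
  hasSum_subtype_iff_indicator.1 summable_properPowerSum.hasSum

lemma hasSum_indicator_not_prime_logZetaCoeff :
    HasSum ({n : ℕ | ¬n.Prime}.indicator logZetaCoeff) (∑' p : Nat.Primes, properPowerSum p) :=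
  hasSum_of_forall_hasSum_prime_pow
    (fun _ => Set.indicator_nonneg (fun n _ => logZetaCoeff_nonneg n) _)
    (fun n hn => by simp only [Set.indicator, logZetaCoeff_eq_zero hn, ite_self])
    (fun p => hasSum_indicator_not_prime_logZetaCoeff_pow p.2) summable_properPowerSum

lemma tendsto_sum_Ioc_of_hasSum {f : ℕ → ℝ} {a : ℝ} (hf : f 0 = 0) (h : HasSum f a) :
    Tendsto (fun n => ∑ k ∈ Ioc 0 n, f k) atTop (𝓝 a) := by
  refine ((tendsto_add_atTop_iff_nat 1).2 h.tendsto_sum_nat).congr fun n => ?_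
  rw [range_eq_Ico, sum_eq_sum_Ico_succ_bot n.succ_pos, hf, zero_add]
  rfl

lemma sum_primesLE_neg_log_one_sub_inv (n : ℕ) :
    ∑ p ∈ n.primesLE, -Real.log (1 - (p : ℝ)⁻¹)
      = ∑ k ∈ Ioc 0 n, logZetaCoeff k + (∑ k ∈ Ioc 0 n, {p : ℕ | p.Prime}.indicator properPowerSum k
        - ∑ k ∈ Ioc 0 n, {n : ℕ | ¬n.Prime}.indicator logZetaCoeff k) := by
  rw [Nat.primesLE_eq_filter_Ioc_zero, sum_filter, ← sum_sub_distrib, ← sum_add_distrib]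
  refine sum_congr rfl fun p _ => ?_
  by_cases hp : p.Prime
  · have := logZetaCoeff_prime_pow hp one_ne_zero
    simp only [pow_one, Nat.cast_one, div_one] at this
    simp only [Set.indicator, Set.mem_ofPred_eq, hp, not_true_eq_false, if_true, if_false,
      properPowerSum, this]
    ring
  · simp [hp]

lemma one_sub_inv_prime_pos {p : ℕ} (hp : p.Prime) : 0 < 1 - (p : ℝ)⁻¹ :=
  sub_pos.2 (inv_lt_one_of_one_lt₀ (by exact_mod_cast hp.one_lt))

theorem tendsto_log_mul_prod_primesLE_one_sub_inv :
    Tendsto (fun n : ℕ => Real.log n * ∏ p ∈ n.primesLE, (1 - (p : ℝ)⁻¹)) atTop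
      (𝓝 (Real.exp (-Real.eulerMascheroniConstant))) := by
  have hlog : Tendsto (fun n : ℕ => ∑ p ∈ n.primesLE, -Real.log (1 - (p : ℝ)⁻¹)
      - Real.log (Real.log n)) atTop (𝓝 Real.eulerMascheroniConstant) := by
    have hprime := tendsto_sum_Ioc_of_hasSum (by simp [Nat.not_prime_zero])
      hasSum_indicator_prime_properPowerSum
    have hnotPrime := tendsto_sum_Ioc_of_hasSum (by simp [logZetaCoeff])
      hasSum_indicator_not_prime_logZetaCoeff
    have h := tendsto_sum_logZetaCoeff_sub_log_log.add (hprime.sub hnotPrime)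
    rw [sub_self, add_zero] at h
    refine h.congr fun n => ?_
    rw [sum_primesLE_neg_log_one_sub_inv]
    ring
  refine ((Real.continuous_exp.tendsto _).comp hlog.neg).congr' ?_
  filter_upwards [eventually_gt_atTop 1] with n hn
  have hlogn : 0 < Real.log n := Real.log_pos (by exact_mod_cast hn)
  rw [Function.comp_apply, neg_sub, sub_eq_add_neg, ← sum_neg_distrib, Real.exp_add,
    Real.exp_log hlogn, Real.exp_sum]
  exact congrArg _ (prod_congr rfl fun p hp => by rw [neg_neg,
    Real.exp_log (one_sub_inv_prime_pos (Nat.prime_of_mem_primesLE hp))])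

/-! ### Lower bounds for the totient function -/

lemma totient_div_eq_prod_primeFactors {n : ℕ} (hn : n ≠ 0) :
    (n.totient : ℝ) / n = ∏ p ∈ n.primeFactors, (1 - (p : ℝ)⁻¹) := by
  have h := congrArg (fun q : ℚ => (q : ℝ)) (Nat.totient_eq_mul_prod_factors n)
  push_cast at h
  rw [h, mul_div_cancel_left₀ _ (by exact_mod_cast hn)]

lemma card_primeFactors_filter_not_le_mul_log_le_log {n : ℕ} (hn : n ≠ 0) (y : ℕ) :
    #{p ∈ n.primeFactors | ¬p ≤ y} * Real.log (y + 1) ≤ Real.log n := by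
  have hpow : (y + 1) ^ #{p ∈ n.primeFactors | ¬p ≤ y} ≤ n := by
    refine (Finset.pow_card_le_prod _ id _ fun p hp => not_le.1 (mem_filter.1 hp).2).trans ?_
    exact Nat.le_of_dvd (Nat.pos_of_ne_zero hn)
      ((prod_dvd_prod_of_subset _ _ _ (filter_subset _ _)).trans (Nat.prod_primeFactors_dvd n))
  rw [← Real.log_pow]
  exact Real.log_le_log (by positivity) (by exact_mod_cast hpow)

lemma prod_primesLE_le_prod_primeFactors_filter_le (n y : ℕ) :
    ∏ p ∈ y.primesLE, (1 - (p : ℝ)⁻¹) ≤ ∏ p ∈ n.primeFactors with p ≤ y, (1 - (p : ℝ)⁻¹) := by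
  refine prod_le_prod_of_subset_of_le_one (fun p hp => ?_)
    (fun p hp => (one_sub_inv_prime_pos (Nat.prime_of_mem_primesLE hp)).le)
    fun p _ _ => sub_le_self _ (by positivity)
  rw [mem_filter] at hp
  exact Nat.mem_primesLE.2 ⟨hp.2, Nat.prime_of_mem_primeFactors hp.1⟩

lemma one_sub_inv_log_le_prod_primeFactors_filter_not_le {n y : ℕ} (hn : n ≠ 0) (hy : 1 ≤ y)
    (hny : Real.log n ≤ y + 1) :
    1 - (Real.log (y + 1))⁻¹ ≤ ∏ p ∈ n.primeFactors with ¬p ≤ y, (1 - (p : ℝ)⁻¹) := by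
  have hlog : 0 < Real.log (y + 1) := Real.log_pos (by norm_cast; omega)
  set k := #{p ∈ n.primeFactors | ¬p ≤ y}
  have hinv : ((y : ℝ) + 1)⁻¹ ≤ 1 := inv_le_one_of_one_le₀ (by norm_cast; omega)
  have hk : k * ((y : ℝ) + 1)⁻¹ ≤ (Real.log (y + 1))⁻¹ := by
    rw [← div_eq_mul_inv, div_le_iff₀ (by positivity), ← div_eq_inv_mul, le_div_iff₀ hlog]
    exact (card_primeFactors_filter_not_le_mul_log_le_log hn y).trans hny
  calc 1 - (Real.log (y + 1))⁻¹ ≤ 1 + k * -((y : ℝ) + 1)⁻¹ := by linarith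
    _ ≤ (1 + -((y : ℝ) + 1)⁻¹) ^ k := one_add_mul_le_pow (by linarith) k
    _ = ∏ p ∈ n.primeFactors with ¬p ≤ y, (1 - ((y : ℝ) + 1)⁻¹) := by
      rw [prod_const, sub_eq_add_neg]
    _ ≤ ∏ p ∈ n.primeFactors with ¬p ≤ y, (1 - (p : ℝ)⁻¹) := by
      refine prod_le_prod (fun _ _ => by linarith) fun p hp => ?_
      have : (y : ℝ) + 1 ≤ p := by exact_mod_cast not_le.1 (mem_filter.1 hp).2
      gcongr

lemma prod_primesLE_mul_le_totient_div {n y : ℕ} (hn : n ≠ 0) (hy : 1 ≤ y)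
    (hny : Real.log n ≤ y + 1) :
    (∏ p ∈ y.primesLE, (1 - (p : ℝ)⁻¹)) * (1 - (Real.log (y + 1))⁻¹) ≤ (n.totient : ℝ) / n := by
  rw [totient_div_eq_prod_primeFactors hn,
    ← prod_filter_mul_prod_filter_not n.primeFactors (· ≤ y)]
  exact (mul_le_mul_of_nonneg_left (one_sub_inv_log_le_prod_primeFactors_filter_not_le hn hy hny)
    (prod_nonneg fun p hp => (one_sub_inv_prime_pos (Nat.prime_of_mem_primesLE hp)).le)).trans
    (mul_le_mul_of_nonneg_right (prod_primesLE_le_prod_primeFactors_filter_le n y)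
      (prod_nonneg fun p hp => (one_sub_inv_prime_pos
        (Nat.prime_of_mem_primeFactors (mem_filter.1 hp).1)).le))

theorem eventually_exp_neg_gamma_sub_le_totient_div_mul_log_log {η : ℝ} (hη : 0 < η) :
    ∀ᶠ n : ℕ in atTop, Real.exp (-Real.eulerMascheroniConstant) - η
      ≤ (n.totient : ℝ) / n * Real.log (Real.log n) := by
  have hlog : Tendsto (fun y : ℕ => (Real.log (y + 1))⁻¹) atTop (𝓝 0) :=
    (Real.tendsto_log_atTop.comp
      (tendsto_atTop_add_const_right _ 1 tendsto_natCast_atTop_atTop)).inv_tendsto_atTop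
  have hprod := tendsto_log_mul_prod_primesLE_one_sub_inv.mul (hlog.const_sub 1)
  rw [sub_zero, mul_one] at hprod
  have hfloor : Tendsto (fun n : ℕ => ⌊Real.log n⌋₊) atTop atTop :=
    tendsto_nat_floor_atTop.comp (Real.tendsto_log_atTop.comp tendsto_natCast_atTop_atTop)
  filter_upwards [hfloor.eventually (hprod.eventually (le_mem_nhds (sub_lt_self _ hη))),
    hfloor.eventually (eventually_ge_atTop 1), eventually_ne_atTop 0] with n hle hy hn
  have hy_le : (⌊Real.log n⌋₊ : ℝ) ≤ Real.log n := Nat.floor_le (Real.log_natCast_nonneg n)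
  have htot := prod_primesLE_mul_le_totient_div hn hy (Nat.lt_floor_add_one (Real.log n)).le
  refine hle.trans ?_
  rw [mul_assoc, mul_comm]
  exact mul_le_mul htot (Real.log_le_log (by exact_mod_cast hy) hy_le)
    (Real.log_natCast_nonneg _) (by positivity)

lemma exists_antitone_tendsto_zero_of_eventually_le {g : ℕ → ℝ}
    (hg : ∀ η > 0, ∀ᶠ n in atTop, g n ≤ η) :
    ∃ ε : ℕ → ℝ, Antitone ε ∧ (∀ n, 0 < ε n) ∧ Tendsto ε atTop (𝓝 0) ∧ ∀ n, g n ≤ ε n := by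
  let h : ℕ → ℝ := fun n => max (g n) (1 / ((n : ℝ) + 1))
  have h_pos : ∀ n, 0 < h n := fun n => lt_max_of_lt_right Nat.one_div_pos_of_nat
  have h_le : ∀ η > 0, ∀ᶠ n in atTop, h n ≤ η := fun η hη => by
    filter_upwards [hg η hη,
      tendsto_one_div_add_atTop_nhds_zero_nat.eventually (ge_mem_nhds hη)] with n h₁ h₂
    exact max_le h₁ h₂
  have h_bdd : BddAbove (Set.range h) :=
    (show IsBoundedUnder (· ≤ ·) atTop h from ⟨1, h_le 1 one_pos⟩).bddAbove_range
  have le_iSup : ∀ n k, n ≤ k → h k ≤ ⨆ j, h (n + j) := fun n k hnk => by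
    obtain ⟨j, rfl⟩ := Nat.exists_eq_add_of_le hnk
    exact le_ciSup (h_bdd.mono (Set.range_comp_subset_range (n + ·) h)) j
  have iSup_pos : ∀ n, 0 < ⨆ j, h (n + j) := fun n => (h_pos n).trans_le (le_iSup n n le_rfl)
  refine ⟨fun n => ⨆ j, h (n + j), fun a b hab => ciSup_le fun j => le_iSup a (b + j) (by omega),
    iSup_pos, tendsto_order.2 ⟨fun b hb => .of_forall fun n => hb.trans (iSup_pos n),
      fun b hb => ?_⟩, fun n => (le_max_left _ _).trans (le_iSup n n le_rfl)⟩
  obtain ⟨n₀, hn₀⟩ := eventually_atTop.1 (h_le (b / 2) (half_pos hb))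
  filter_upwards [eventually_ge_atTop n₀] with n hn
  exact (ciSup_le fun j => hn₀ _ (by omega)).trans_lt (half_lt_self hb)

theorem exists_antitone_forall_exp_neg_gamma_sub_le :
    ∃ ε : ℕ → ℝ, Antitone ε ∧ (∀ n, 0 < ε n) ∧ Tendsto ε atTop (𝓝 0) ∧
      ∀ n : ℕ, Real.exp (-Real.eulerMascheroniConstant) - ε n
        ≤ (n.totient : ℝ) / n * Real.log (Real.log n) := by
  obtain ⟨ε, hanti, hpos, hlim, hle⟩ := exists_antitone_tendsto_zero_of_eventually_le
    (g := fun n : ℕ => Real.exp (-Real.eulerMascheroniConstant)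
      - (n.totient : ℝ) / n * Real.log (Real.log n)) fun η hη =>
      (eventually_exp_neg_gamma_sub_le_totient_div_mul_log_log hη).mono fun n hn => by linarith
  exact ⟨ε, hanti, hpos, hlim, fun n => by linarith [hle n]⟩

theorem exists_pos_forall_le_totient_div_mul_max_log_log :
    ∃ c : ℝ, 0 < c ∧ ∀ n : ℕ, 0 < n →
      c ≤ (n.totient : ℝ) / n * max 1 (Real.log (Real.log n)) := by
  have hγ := Real.exp_pos (-Real.eulerMascheroniConstant)
  set E := Real.exp (-Real.eulerMascheroniConstant)
  obtain ⟨n₀, hn₀⟩ := eventually_atTop.1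
    (eventually_exp_neg_gamma_sub_le_totient_div_mul_log_log (half_pos hγ))
  refine ⟨min (E / 2) (1 / (n₀ + 1)), by positivity, fun n hn => ?_⟩
  rcases le_total n₀ n with hle | hle
  · calc min (E / 2) (1 / (n₀ + 1)) ≤ E - E / 2 := by linarith [min_le_left (E / 2) (1 / (n₀ + 1))]
      _ ≤ n.totient / n * Real.log (Real.log n) := hn₀ n hle
      _ ≤ n.totient / n * max 1 (Real.log (Real.log n)) := by gcongr; exact le_max_right _ _
  · calc min (E / 2) (1 / (n₀ + 1)) ≤ 1 / (n₀ + 1) := min_le_right _ _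
      _ ≤ n.totient / n := by
        gcongr
        · exact_mod_cast Nat.totient_pos.2 hn
        · exact_mod_cast hle.trans n₀.le_succ
      _ ≤ n.totient / n * max 1 (Real.log (Real.log n)) :=
        le_mul_of_one_le_right (by positivity) (le_max_left _ _)

end Mertens

namespace Shor

open Finset MeasureTheory

/-! ### Amplitudes of the outcomes -/

lemma psi1_apply (L : ℕ) (x b : Reg L) :
    psi1 L (x, b) = if b = 0 then ((√((2 ^ L : ℕ) : ℝ) : ℝ) : ℂ)⁻¹ else 0 := by
  rw [psi1, psi0, Matrix.mulVec_single_one]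
  simp [Matrix.kroneckerMap_apply, fourier, Matrix.one_apply]

section

variable (L : ℕ) (f : ℕ → ℕ)

lemma psi2_apply (x b : Reg L) :
    psi2 L f (x, b) =
      if Fin.ofNat (2 ^ L) (f x) = b then ((√((2 ^ L : ℕ) : ℝ) : ℝ) : ℂ)⁻¹ else 0 := by
  rw [psi2, Matrix.mulVec, dotProduct, Fintype.sum_prod_type, sum_eq_single x, sum_eq_single 0]
  · simp only [oracle, Matrix.of_apply, psi1_apply, zero_add, Prod.mk.injEq, true_and, if_true,
      ite_mul, one_mul, zero_mul, eq_comm]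
  · intro c _ hc
    simp [psi1_apply, hc]
  · simp
  · intro x' _ hx'
    refine sum_eq_zero fun c _ => ?_
    simp [oracle, hx'.symm]
  · simp

lemma psi3_apply (y b : Reg L) :
    psi3 L f (y, b) = ((2 ^ L : ℕ) : ℂ)⁻¹ *
      ∑ x : Reg L with Fin.ofNat (2 ^ L) (f (x : Reg L)) = b, omega L ^ ((x : ℕ) * (y : ℕ)) := by
  have hsqrt : ((√((2 ^ L : ℕ) : ℝ) : ℝ) : ℂ)⁻¹ * ((√((2 ^ L : ℕ) : ℝ) : ℝ) : ℂ)⁻¹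
      = ((2 ^ L : ℕ) : ℂ)⁻¹ := by
    rw [← mul_inv, ← Complex.ofReal_mul, Real.mul_self_sqrt (by positivity), Complex.ofReal_natCast]
  rw [psi3, Matrix.mulVec, dotProduct, Fintype.sum_prod_type, mul_sum, sum_filter]
  refine sum_congr rfl fun x _ => ?_
  rw [sum_eq_single b]
  · simp only [Matrix.kroneckerMap_apply, fourier, Matrix.of_apply, Matrix.one_apply_eq,
      psi2_apply, mul_one]
    split_ifs with h
    · rw [← hsqrt]; ring
    · simp
  · intro c _ hc
    simp [Matrix.kroneckerMap_apply, Matrix.one_apply_ne hc.symm]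
  · simp

lemma prob_eq_sum_norm_sq (y : Reg L) :
    prob L f y = ∑ b, (‖∑ x : Reg L with Fin.ofNat (2 ^ L) (f (x : Reg L)) = b,
      omega L ^ ((x : ℕ) * (y : ℕ))‖ / ((2 ^ L : ℕ) : ℝ)) ^ 2 := by
  refine sum_congr rfl fun b _ => ?_
  rw [psi3_apply, norm_mul, norm_inv, Complex.norm_natCast, div_eq_inv_mul]

end

lemma sum_range_filter_mod_eq {M : Type*} [AddCommMonoid M] {P r : ℕ} (hr : r < P) (Q : ℕ)
    (g : ℕ → M) :
    ∑ x ∈ range Q with x % P = r, g x = ∑ k ∈ range ((Q - r) ⌈/⌉ P), g (r + k * P) := by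
  have hP : 0 < P := Nat.zero_lt_of_lt hr
  refine (sum_nbij' (fun k => r + k * P) (· / P) (fun k hk => ?_) (fun x hx => ?_)
    (fun k _ => ?_) (fun x hx => ?_) fun _ _ => rfl).symm
  · rw [mem_range, ← not_le, ceilDiv_le_iff_le_mul hP, mul_comm] at hk
    simp only [mem_filter, mem_range, Nat.add_mul_mod_self_right, Nat.mod_eq_of_lt hr, and_true]
    omega
  · rw [mem_filter, mem_range] at hx
    rw [mem_range, ← not_le, ceilDiv_le_iff_le_mul hP]
    have := Nat.mod_add_div x P
    omega
  · rw [Nat.add_mul_div_right _ _ hP, Nat.div_eq_of_lt hr, zero_add]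
  · rw [mem_filter] at hx
    rw [← hx.2, mul_comm, Nat.mod_add_div]

lemma ceilDiv_sub_mul_lt {P : ℕ} (hP : 0 < P) (Q r : ℕ) : (Q - r) ⌈/⌉ P * P < Q + P := by
  have := Nat.div_mul_le_self (Q - r + P - 1) P
  rw [Nat.ceilDiv_eq_add_pred_div]
  omega

lemma lt_ceilDiv_sub_mul_add {P r : ℕ} (hr : r < P) (Q : ℕ) : Q < (Q - r) ⌈/⌉ P * P + P := by
  have : Q - r ≤ P * ((Q - r) ⌈/⌉ P) :=
    (ceilDiv_le_iff_le_mul (Nat.zero_lt_of_lt hr)).1 le_rfl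
  rw [mul_comm]
  omega

theorem sum_norm_geom_sum_sq_le_prob {L P : ℕ} {f : ℕ → ℕ} (hf : ∀ a b, f a = f b ↔ a ≡ b [MOD P])
    (hlt : ∀ a, f a < 2 ^ L) (y : Reg L) :
    ∑ r ∈ range P, (‖∑ k ∈ range ((2 ^ L - r) ⌈/⌉ P), (omega L ^ (P * (y : ℕ))) ^ k‖
      / ((2 ^ L : ℕ) : ℝ)) ^ 2 ≤ prob L f y := by
  have hval : ∀ a b, Fin.ofNat (2 ^ L) (f a) = Fin.ofNat (2 ^ L) (f b) ↔ a % P = b % P :=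
    fun a b => by
      rw [Fin.ext_iff, Fin.val_ofNat, Fin.val_ofNat, Nat.mod_eq_of_lt (hlt a),
        Nat.mod_eq_of_lt (hlt b), hf, Nat.ModEq]
  have hinj : Set.InjOn (fun r => Fin.ofNat (2 ^ L) (f r)) (range P) := fun r hr s hs hrs => by
    rw [coe_range, Set.mem_Iio] at hr hs
    simpa only [Nat.mod_eq_of_lt hr, Nat.mod_eq_of_lt hs] using (hval r s).1 hrs
  have hnorm : ‖omega L‖ = 1 := (omega_primitive L).norm'_eq_one (by positivity)
  rw [prob_eq_sum_norm_sq]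
  refine le_trans (le_of_eq ?_) (sum_le_sum_of_subset_of_nonneg
    (subset_univ ((range P).image fun r => Fin.ofNat (2 ^ L) (f r))) fun _ _ _ => sq_nonneg _)
  rw [sum_image hinj]
  refine sum_congr rfl fun r hr => ?_
  rw [mem_range] at hr
  congr 2
  have hclass : ∑ x : Reg L with Fin.ofNat (2 ^ L) (f (x : Reg L)) = Fin.ofNat (2 ^ L) (f r),
      omega L ^ ((x : ℕ) * (y : ℕ))
        = ∑ x ∈ range (2 ^ L) with x % P = r, omega L ^ (x * (y : ℕ)) := by
    simp only [hval, Nat.mod_eq_of_lt hr]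
    rw [sum_filter, sum_filter,
      Fin.sum_univ_eq_sum_range (fun x => if x % P = r then omega L ^ (x * (y : ℕ)) else 0)]
  have hterm : ∀ k, omega L ^ ((r + k * P) * (y : ℕ))
      = omega L ^ (r * (y : ℕ)) * (omega L ^ (P * (y : ℕ))) ^ k := fun k => by
    rw [← pow_mul, ← pow_add]
    congr 1
    ring
  simp only [hclass, sum_range_filter_mod_eq hr, hterm, ← mul_sum, norm_mul, norm_pow, hnorm,
    one_pow, one_mul]

lemma mul_sin_le_sin_mul {t x : ℝ} (ht₀ : 0 ≤ t) (ht₁ : t ≤ 1) (hx₀ : 0 ≤ x) (hx₁ : x ≤ Real.pi) :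
    t * Real.sin x ≤ Real.sin (t * x) := by
  simpa using strictConcaveOn_sin_Icc.concaveOn.2 (Set.left_mem_Icc.2 Real.pi_nonneg)
    ⟨hx₀, hx₁⟩ (sub_nonneg.2 ht₁) ht₀ (sub_add_cancel 1 t)

lemma sin_half_mul_abs_le_norm_geom_sum_mul (φ : ℝ) (K : ℕ) :
    Real.sin (K * |φ| / 2) ≤ ‖∑ k ∈ range K, Complex.exp (Complex.I * φ) ^ k‖ * (|φ| / 2) := by
  have hpow : Complex.exp (Complex.I * φ) ^ K = Complex.exp (Complex.I * ((K * φ : ℝ) : ℂ)) := by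
    rw [← Complex.exp_nat_mul]
    congr 1
    push_cast
    ring
  have hle : ‖Complex.exp (Complex.I * φ) - 1‖ ≤ |φ| := Real.norm_exp_I_mul_ofReal_sub_one_le
  have hsin : 2 * Real.sin (K * |φ| / 2) ≤ ‖Complex.exp (Complex.I * φ) ^ K - 1‖ := by
    rw [hpow, Complex.norm_exp_I_mul_ofReal_sub_one, norm_mul, Real.norm_two]
    gcongr
    rcases abs_choice φ with h | h
    · rw [h]
      exact Real.le_norm_self _
    · rw [h, mul_neg, neg_div, Real.sin_neg]
      exact (Real.le_norm_self _).trans_eq (norm_neg _)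
  rw [← geom_sum_mul, norm_mul] at hsin
  have := mul_le_mul_of_nonneg_left hle
    (norm_nonneg (∑ k ∈ range K, Complex.exp (Complex.I * φ) ^ k))
  linarith

lemma sin_half_mul_le_norm_geom_sum_mul {φ ψ : ℝ} {K : ℕ} (hφ : |φ| ≤ ψ)
    (hψ : K * ψ ≤ 2 * Real.pi) :
    Real.sin (K * ψ / 2) ≤ ‖∑ k ∈ range K, Complex.exp (Complex.I * φ) ^ k‖ * (ψ / 2) := by
  have hψ₀ : 0 ≤ ψ := (abs_nonneg φ).trans hφ
  rcases eq_or_ne φ 0 with rfl | hφ₀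
  · simpa [mul_div_assoc] using Real.sin_le (by positivity : 0 ≤ K * ψ / 2)
  have hφ_pos : 0 < |φ| := abs_pos.2 hφ₀
  -- By concavity of `sin` on `[0, π]`, the quotient `sin (K φ / 2) / φ` decreases in `φ > 0`.
  have hconc := mul_sin_le_sin_mul (t := |φ| / ψ) (by positivity) (div_le_one_of_le₀ hφ hψ₀)
    (by positivity : 0 ≤ K * ψ / 2) (by linarith)
  have hψ_pos : 0 < ψ := hφ_pos.trans_le hφ
  rw [show |φ| / ψ * (K * ψ / 2) = K * |φ| / 2 by field_simp, div_mul_eq_mul_div,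
    div_le_iff₀ hψ_pos] at hconc
  refine le_of_mul_le_mul_left ?_ hφ_pos
  have := mul_le_mul_of_nonneg_right (sin_half_mul_abs_le_norm_geom_sum_mul φ K) hψ₀
  linarith

lemma omega_pow_mul_eq_exp {L P y : ℕ} (e : ℤ) :
    omega L ^ (P * y) = Complex.exp (Complex.I *
      ((2 * Real.pi * ((P * y - e * 2 ^ L : ℤ) : ℝ) / ((2 ^ L : ℕ) : ℝ) : ℝ) : ℂ)) := by
  rw [omega, ← Complex.exp_nat_mul, Complex.exp_eq_exp_iff_exists_int]
  refine ⟨e, ?_⟩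
  push_cast
  field_simp
  ring

lemma one_sub_le_sin_pi_div_two_mul {x δ : ℝ} (hx : |x - 1| ≤ δ) (hδ : δ ≤ 1) :
    1 - δ ≤ Real.sin (Real.pi / 2 * x) := by
  have hπ := Real.pi_pos
  have hcos : 1 - 2 / Real.pi * (Real.pi / 2 * |x - 1|) ≤ Real.cos (Real.pi / 2 * |x - 1|) :=
    Real.one_sub_mul_le_cos (by positivity) (mul_le_of_le_one_right (by positivity) (hx.trans hδ))
  rw [← mul_assoc, div_mul_div_cancel₀' two_ne_zero, div_self hπ.ne', one_mul] at hcos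
  rw [← Real.cos_sub_pi_div_two, ← mul_sub_one, ← Real.cos_abs, abs_mul,
    abs_of_pos (by positivity : 0 < Real.pi / 2)]
  linarith

/-- With `Q = 2 ^ L`, the outcome `y` is within `1 / 2` of the multiple `e * (Q / P)` of `Q / P`.
This is how the paper's condition `|{Py}_Q| ≤ P / 2` enters the estimates, cleared of
denominators. -/
def IsNear (L P y : ℕ) (e : ℤ) : Prop := 2 * |(P : ℤ) * y - e * 2 ^ L| ≤ P

lemma IsNear.le_norm_geom_sum {L P K y : ℕ} {e : ℤ} (he : IsNear L P y e) (hPL : P ≤ 2 ^ L)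
    (hK_lt : K * P < 2 ^ L + P) (hlt_K : 2 ^ L < K * P + P) :
    1 - (P : ℝ) / 2 ^ L ≤
      ‖∑ k ∈ range K, (omega L ^ (P * y)) ^ k‖ * (Real.pi * P / 2 ^ L / 2) := by
  have hπ := Real.pi_pos
  have hQ : (0 : ℝ) < 2 ^ L := by positivity
  have hPL' : (P : ℝ) ≤ 2 ^ L := by exact_mod_cast hPL
  have hK_lt' : (K : ℝ) * P < 2 ^ L + P := by exact_mod_cast hK_lt
  have hlt_K' : (2 : ℝ) ^ L < K * P + P := by exact_mod_cast hlt_K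
  have he' : 2 * |(P : ℝ) * y - e * 2 ^ L| ≤ P := by exact_mod_cast he
  have hangle : |2 * Real.pi * ((P * y - e * 2 ^ L : ℤ) : ℝ) / ((2 ^ L : ℕ) : ℝ)|
      ≤ Real.pi * P / 2 ^ L := by
    push_cast
    rw [abs_div, abs_mul, abs_of_pos Real.two_pi_pos, abs_of_pos hQ, mul_comm 2, mul_assoc]
    gcongr
  have hperiods : |K * ((P : ℝ) / 2 ^ L) - 1| ≤ (P : ℝ) / 2 ^ L := by
    rw [← mul_div_assoc, div_sub_one hQ.ne', abs_div, abs_of_pos hQ]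
    gcongr
    exact abs_le.2 ⟨by linarith, by linarith⟩
  rw [omega_pow_mul_eq_exp e]
  refine (one_sub_le_sin_pi_div_two_mul hperiods (div_le_one_of_le₀ hPL' hQ.le)).trans ?_
  rw [show Real.pi / 2 * (K * (P / 2 ^ L)) = K * (Real.pi * P / 2 ^ L) / 2 by ring]
  refine sin_half_mul_le_norm_geom_sum_mul hangle ?_
  rw [← mul_div_assoc, div_le_iff₀ hQ]
  nlinarith

theorem IsNear.le_prob {L P : ℕ} {f : ℕ → ℕ} {y : Reg L} {e : ℤ} (he : IsNear L P y e)
    (hf : ∀ a b, f a = f b ↔ a ≡ b [MOD P]) (hlt : ∀ a, f a < 2 ^ L) (hP : 0 < P)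
    (hPL : P ≤ 2 ^ L) :
    4 / Real.pi ^ 2 * (1 / P) * (1 - (P : ℝ) / 2 ^ L) ^ 2 ≤ prob L f y := by
  have hQ : (0 : ℝ) < 2 ^ L := by positivity
  have hδ : 0 ≤ 1 - (P : ℝ) / 2 ^ L :=
    sub_nonneg.2 (div_le_one_of_le₀ (by exact_mod_cast hPL) hQ.le)
  refine le_trans ?_ (sum_norm_geom_sum_sq_le_prob hf hlt y)
  calc 4 / Real.pi ^ 2 * (1 / P) * (1 - (P : ℝ) / 2 ^ L) ^ 2
      = ∑ _r ∈ range P, (2 / Real.pi * (1 - (P : ℝ) / 2 ^ L) / P) ^ 2 := by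
        rw [sum_const, card_range, nsmul_eq_mul]
        field_simp
        ring
    _ ≤ _ := sum_le_sum fun r hr => by
        have hnorm := he.le_norm_geom_sum hPL (ceilDiv_sub_mul_lt hP _ r)
          (lt_ceilDiv_sub_mul_add (mem_range.1 hr) _)
        gcongr ?_ ^ 2
        refine le_trans (by gcongr) (le_of_eq ?_ : 2 / Real.pi * (_ * _) / P ≤ _)
        push_cast
        field_simp

/-! ### Probability of a good outcome -/

section

variable {L P : ℕ}

lemma exists_isNear (hPL : P ≤ 2 ^ L) {e : ℕ} (he : e < P) : ∃ y : Reg L, IsNear L P y e := by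
  set y := (2 * e * 2 ^ L + P) / (2 * P)
  have hy_le : y * (2 * P) ≤ 2 * e * 2 ^ L + P := Nat.div_mul_le_self _ _
  have hlt_y : 2 * e * 2 ^ L + P < y * (2 * P) + 2 * P := Nat.lt_div_mul_add (by omega)
  have hy : y < 2 ^ L := by
    have : (e + 1) * 2 ^ L ≤ P * 2 ^ L := Nat.mul_le_mul_right _ he
    exact (Nat.div_lt_iff_lt_mul (by omega)).2 (by nlinarith)
  refine ⟨⟨y, hy⟩, ?_⟩
  zify at hy_le hlt_y
  have : |2 * ((P : ℤ) * y - e * 2 ^ L)| ≤ P := abs_le.2 ⟨by linarith, by linarith⟩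
  rwa [abs_mul, abs_two] at this

variable {y : Reg L} {e : ℤ}

lemma IsNear.abs_div_sub_lt (he : IsNear L P y e) (hPL : P < 2 ^ L) :
    |(P : ℚ) * (y : ℕ) / ((2 ^ L : ℕ) : ℚ) - e| < 1 / 2 := by
  have hQ : (0 : ℚ) < ((2 ^ L : ℕ) : ℚ) := by positivity
  have he' : 2 * |(P : ℚ) * (y : ℕ) - e * ((2 ^ L : ℕ) : ℚ)| ≤ P := by exact_mod_cast he
  have hPL' : (P : ℚ) < ((2 ^ L : ℕ) : ℚ) := by exact_mod_cast hPL
  rw [div_sub' hQ.ne', abs_div, abs_of_pos hQ, div_lt_iff₀ hQ, mul_comm _ (e : ℚ)]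
  linarith

lemma IsNear.mem_Y (he : IsNear L P y e) (hPL : P < 2 ^ L) : y ∈ Y L P := by
  have hlt := abs_lt.1 (he.abs_div_sub_lt hPL)
  have hceil : ⌈(((P : ℤ) * ((y : ℕ) : ℤ) : ℤ) : ℚ) / ((2 ^ L : ℕ) : ℚ) - 1 / 2⌉ = e := by
    rw [Int.ceil_eq_iff]
    push_cast at hlt ⊢
    constructor <;> linarith
  rw [Y, Set.mem_ofPred_eq, residue, hceil, le_div_iff₀ two_pos, mul_comm, mul_comm _ e]
  exact_mod_cast he

lemma IsNear.d_eq (he : IsNear L P y e) (hPL : P < 2 ^ L) : d L P y = e := by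
  have hlt := abs_lt.1 (he.abs_div_sub_lt hPL)
  rw [d, round_eq, Int.floor_eq_iff, div_mul_eq_mul_div]
  constructor <;> linarith

end

lemma source_real_coe_finset (L : ℕ) (f : ℕ → ℕ) (S : Finset (Reg L)) :
    (source L f).toMeasure.real S = ∑ y ∈ S, prob L f y := by
  rw [measureReal_def, PMF.toMeasure_apply_finset,
    ENNReal.toReal_sum fun y _ => PMF.apply_ne_top _ y]
  refine sum_congr rfl fun y _ => ?_
  rw [source, PMF.ofFintype_apply, ENNReal.toReal_ofReal (prob_nonneg _ _ _)]

theorem totient_div_mul_le_source_real_good {L P : ℕ} {f : ℕ → ℕ}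
    (hf : ∀ a b, f a = f b ↔ a ≡ b [MOD P]) (hlt : ∀ a, f a < 2 ^ L) (hP : 0 < P)
    (hPL : P < 2 ^ L) :
    4 / Real.pi ^ 2 * (P.totient / P) * (1 - (P : ℝ) / 2 ^ L) ^ 2
      ≤ (source L f).toMeasure.real (good L P) := by
  choose! y hy using fun (e : ℕ) (he : e < P) => exists_isNear hPL.le he
  set D := {e ∈ range P | P.Coprime e} with hD
  have hnear : ∀ e ∈ D, IsNear L P (y e) e := fun e he =>
    hy e (mem_range.1 (mem_filter.1 he).1)
  have hinj : Set.InjOn y D := fun a ha b hb hab => by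
    have hd := (hnear a ha).d_eq hPL
    rw [hab, (hnear b hb).d_eq hPL] at hd
    exact_mod_cast hd.symm
  have hgood : ↑(D.image y) ⊆ good L P := by
    rw [coe_image]
    rintro _ ⟨e, he, rfl⟩
    refine ⟨(hnear e he).mem_Y hPL, ?_⟩
    rw [(hnear e he).d_eq hPL, Int.gcd_natCast_natCast]
    exact (mem_filter.1 he).2.symm
  calc 4 / Real.pi ^ 2 * (P.totient / P) * (1 - (P : ℝ) / 2 ^ L) ^ 2
      = ∑ _e ∈ D, 4 / Real.pi ^ 2 * (1 / P) * (1 - (P : ℝ) / 2 ^ L) ^ 2 := by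
        rw [sum_const, nsmul_eq_mul, hD, ← Nat.totient_eq_card_coprime]
        ring
    _ ≤ ∑ e ∈ D, prob L f (y e) := sum_le_sum fun e he => (hnear e he).le_prob hf hlt hP hPL.le
    _ = (source L f).toMeasure.real (D.image y) := by
        rw [source_real_coe_finset, sum_image hinj]
    _ ≤ (source L f).toMeasure.real (good L P) := measureReal_mono hgood

lemma probReal_pi_exists_mem {Ω ι : Type*} [Fintype ι] [MeasurableSpace Ω] (μ : Measure Ω)
    [IsProbabilityMeasure μ] {s : Set Ω} (hs : MeasurableSet s) :
    (Measure.pi fun _ : ι => μ).real {ω | ∃ i, ω i ∈ s} = 1 - (1 - μ.real s) ^ Fintype.card ι := by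
  have hcompl : {ω : ι → Ω | ∃ i, ω i ∈ s} = (Set.univ.pi fun _ => sᶜ)ᶜ := by
    ext ω
    simp
  rw [hcompl, probReal_compl_eq_one_sub (.univ_pi fun _ => hs.compl), measureReal_def,
    Measure.pi_pi, prod_const, card_univ, ENNReal.toReal_pow, ← measureReal_def,
    probReal_compl_eq_one_sub hs]

lemma one_sub_exp_neg_le_one_sub_pow {p : ℝ} (hp : p ≤ 1) (k : ℕ) :
    1 - Real.exp (-(p * k)) ≤ 1 - (1 - p) ^ k := by
  gcongr
  calc (1 - p) ^ k ≤ Real.exp (-p) ^ k := by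
        gcongr
        exact Real.one_sub_le_exp_neg p
    _ = Real.exp (-(p * k)) := by
        rw [← Real.exp_nat_mul]
        congr 1
        ring

variable {N m : ℕ}

lemma modExp_eq_modExp_iff (hm : m.Coprime N) (a b : ℕ) :
    modExp N m a = modExp N m b ↔ a ≡ b [MOD period N m] := by
  have hcast : (m : ZMod N) = (ZMod.unitOfCoprime m hm : (ZMod N)ˣ) := by simp
  rw [modExp, modExp, ← Nat.ModEq, ← ZMod.natCast_eq_natCast_iff, Nat.cast_pow, Nat.cast_pow,
    period, hcast, orderOf_units, ← Units.val_pow_eq_pow_val, ← Units.val_pow_eq_pow_val,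
    Units.val_inj, pow_eq_pow_iff_modEq]

lemma period_pos (hN : N ≠ 0) (hm : m.Coprime N) : 0 < period N m := by
  have : NeZero N := ⟨hN⟩
  rw [period, ← ZMod.coe_unitOfCoprime m hm, orderOf_units]
  exact orderOf_pos _

lemma period_lt (hN : 1 < N) (hm : m.Coprime N) : period N m < N := by
  have : NeZero N := ⟨by omega⟩
  rw [period, ← ZMod.coe_unitOfCoprime m hm, orderOf_units]
  refine orderOf_le_card_univ.trans_lt ?_
  rw [ZMod.card_units_eq_totient]
  exact Nat.totient_lt N hN

lemma totient_div_mul_le_goodProb {L : ℕ} (hN : 1 < N) (hm : m.Coprime N)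
    (hQ : N ^ 2 ≤ 2 ^ L) :
    4 / Real.pi ^ 2 * ((period N m).totient / period N m) * (1 - 1 / (N : ℝ)) ^ 2
      ≤ goodProb N m L := by
  have hPN := period_lt hN hm
  have hNQ : N ≤ 2 ^ L := (Nat.le_self_pow two_ne_zero N).trans hQ
  have hN' : (1 : ℝ) < N := by exact_mod_cast hN
  have hδ : (period N m : ℝ) / 2 ^ L ≤ 1 / N := by
    have hQ' : (N : ℝ) ^ 2 ≤ 2 ^ L := by exact_mod_cast hQ
    have hPN' : (period N m : ℝ) ≤ N := by exact_mod_cast hPN.le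
    calc (period N m : ℝ) / 2 ^ L ≤ N / N ^ 2 := by gcongr
      _ = 1 / N := by field_simp
  have hδ₀ : 0 ≤ 1 - 1 / (N : ℝ) := sub_nonneg.2 (div_le_one_of_le₀ hN'.le (by positivity))
  refine le_trans (by gcongr) (totient_div_mul_le_source_real_good (modExp_eq_modExp_iff hm)
    (fun a => (Nat.mod_lt _ (by omega)).trans_le hNQ) (period_pos (by omega) hm)
    (hPN.trans_le hNQ))

section

variable {N m L : ℕ}

lemma lglg_mul_log_two (N : ℕ) : lglg N * Real.log 2 = Real.log (Real.logb 2 N) :=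
  div_mul_cancel₀ _ (Real.log_pos one_lt_two).ne'

lemma half_le_lglg (hN : 2 < N) : 1 / 2 ≤ lglg N := by
  have hN' : (3 : ℝ) ≤ N := by exact_mod_cast hN
  have hlogb : 3 / 2 ≤ Real.logb 2 N := by
    have hcube : ((2 : ℝ) ^ (3 / 2 : ℝ)) ^ 2 = 2 ^ 3 := by
      rw [← Real.rpow_mul_natCast zero_le_two]
      norm_num
    rw [Real.le_logb_iff_rpow_le one_lt_two (by positivity)]
    exact (abs_le_of_sq_le_sq' (by rw [hcube]; nlinarith) (by positivity)).2
  rw [lglg, Real.le_logb_iff_rpow_le one_lt_two (by positivity), ← Real.sqrt_eq_rpow]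
  exact (Real.sqrt_le_iff.2 ⟨by norm_num, by norm_num⟩).trans hlogb

lemma log_log_period_le (hN : 2 < N) (hm : m.Coprime N) :
    Real.log (Real.log (period N m)) ≤ lglg N * Real.log 2 := by
  have hlog2 : 0 < Real.log 2 := Real.log_pos one_lt_two
  have hlglg := half_le_lglg hN
  rcases (Nat.one_le_iff_ne_zero.2 (period_pos (by omega) hm).ne').eq_or_lt with hP | hP
  · rw [← hP, Nat.cast_one, Real.log_one, Real.log_zero]
    positivity
  · have hlog : 0 < Real.log (period N m) := Real.log_pos (by exact_mod_cast hP)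
    have hle : Real.log (period N m) ≤ Real.log N :=
      Real.log_le_log (by positivity) (by exact_mod_cast (period_lt (by omega) hm).le)
    rw [lglg_mul_log_two]
    refine Real.log_le_log hlog (hle.trans ?_)
    rw [Real.logb, le_div_iff₀ hlog2]
    exact mul_le_of_le_one_right (hlog.le.trans hle) (by linarith [Real.log_two_lt_d9])

lemma quarter_le_one_sub_one_div_sq (hN : 2 ≤ N) : 1 / 4 ≤ (1 - 1 / (N : ℝ)) ^ 2 := by
  have hN' : 1 / (N : ℝ) ≤ 1 / 2 := one_div_le_one_div_of_le two_pos (by exact_mod_cast hN)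
  nlinarith

lemma le_goodProb_of_le_totient_div_mul {a b : ℝ} (hN : 1 < N) (hm : m.Coprime N)
    (hQ : N ^ 2 ≤ 2 ^ L) (hb : 0 < b) (ha : a ≤ (period N m).totient / period N m * b) :
    4 / Real.pi ^ 2 * (a / b) * (1 - 1 / (N : ℝ)) ^ 2 ≤ goodProb N m L := by
  refine le_trans ?_ (totient_div_mul_le_goodProb hN hm hQ)
  exact mul_le_mul_of_nonneg_right
    (mul_le_mul_of_nonneg_left ((div_le_iff₀ hb).2 ha) (by positivity)) (sq_nonneg _)

lemma successProb_eq_one_sub_pow (N m L k : ℕ) :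
    successProb N m L k = 1 - (1 - goodProb N m L) ^ k := by
  rw [successProb, probReal_pi_exists_mem _ (Set.toFinite _).measurableSet, Fintype.card_fin,
    goodProb]

lemma one_sub_exp_neg_le_successProb {c C : ℝ} (hc : 0 ≤ c) (hl : 0 < lglg N)
    (hgood : c * (1 / lglg N) ≤ goodProb N m L) :
    1 - Real.exp (-(c * C)) ≤ successProb N m L ⌈C * lglg N⌉₊ := by
  rw [successProb_eq_one_sub_pow]
  refine le_trans ?_ (one_sub_exp_neg_le_one_sub_pow MeasureTheory.measureReal_le_one _)
  refine sub_le_sub_left (Real.exp_le_exp.2 (neg_le_neg ?_)) 1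
  calc c * C = c * (1 / lglg N) * (C * lglg N) := by field_simp
    _ ≤ c * (1 / lglg N) * ⌈C * lglg N⌉₊ := by gcongr; exact Nat.le_ceil _
    _ ≤ goodProb N m L * ⌈C * lglg N⌉₊ := by gcongr

end

theorem exists_antitone_forall_le_goodProb :
    ∃ ε : ℕ → ℝ, Antitone ε ∧ (∀ P, 0 < ε P) ∧ Filter.Tendsto ε Filter.atTop (nhds 0) ∧
      ∀ N m L : ℕ, 2 < N → m.Coprime N → N ^ 2 ≤ 2 ^ L →
        4 / (Real.pi ^ 2 * Real.log 2) *
            ((Real.exp (-Real.eulerMascheroniConstant) - ε (period N m)) / lglg N) *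
            (1 - 1 / (N : ℝ)) ^ 2
          ≤ goodProb N m L := by
  obtain ⟨ε, hanti, hpos, hlim, hle⟩ := Mertens.exists_antitone_forall_exp_neg_gamma_sub_le
  refine ⟨ε, hanti, hpos, hlim, fun N m L hN hm hQ => ?_⟩
  have hlglg := half_le_lglg hN
  have htot : Real.exp (-Real.eulerMascheroniConstant) - ε (period N m)
      ≤ (period N m).totient / period N m * (lglg N * Real.log 2) :=
    (hle _).trans (by gcongr; exact log_log_period_le hN hm)
  convert le_goodProb_of_le_totient_div_mul (by omega) hm hQ (by positivity) htot using 2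
  field_simp

theorem exists_pos_forall_mul_one_div_lglg_le_goodProb :
    ∃ c : ℝ, 0 < c ∧ ∀ N m L : ℕ, 2 < N → m.Coprime N → N ^ 2 ≤ 2 ^ L →
      c * (1 / lglg N) ≤ goodProb N m L := by
  obtain ⟨c, hc, hle⟩ := Mertens.exists_pos_forall_le_totient_div_mul_max_log_log
  refine ⟨c / (2 * Real.pi ^ 2), by positivity, fun N m L hN hm hQ => ?_⟩
  have hlglg := half_le_lglg hN
  have htot : c ≤ (period N m).totient / period N m * (2 * lglg N) := by
    refine (hle _ (period_pos (by omega) hm)).trans ?_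
    gcongr
    refine max_le (by linarith) ((log_log_period_le hN hm).trans ?_)
    nlinarith [Real.log_two_lt_d9]
  calc c / (2 * Real.pi ^ 2) * (1 / lglg N)
      = 4 / Real.pi ^ 2 * (c / (2 * lglg N)) * (1 / 4) := by field_simp
    _ ≤ 4 / Real.pi ^ 2 * (c / (2 * lglg N)) * (1 - 1 / (N : ℝ)) ^ 2 := by
        gcongr
        exact quarter_le_one_sub_one_div_sq hN.le
    _ ≤ goodProb N m L := le_goodProb_of_le_totient_div_mul (by omega) hm hQ (by positivity) htot

lemma Setup.two_lt {N m L : ℕ} (h : Setup N m L) : 2 < N := by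
  obtain ⟨k, hk⟩ := h.odd
  have := h.one_lt
  omega

end Shor

theorem mainTheorem1_general :
    (∃ ε : ℕ → ℝ, Antitone ε ∧ (∀ P, 0 < ε P) ∧ Filter.Tendsto ε Filter.atTop (nhds 0) ∧
      ∀ N m L : ℕ, 2 < N → m.Coprime N → N ^ 2 ≤ 2 ^ L →
        4 / (Real.pi ^ 2 * Real.log 2) *
            ((Real.exp (-Real.eulerMascheroniConstant) - ε (Shor.period N m)) / Shor.lglg N) *
            (1 - 1 / (N : ℝ)) ^ 2
          ≤ Shor.goodProb N m L) ∧
    (∃ c : ℝ, 0 < c ∧ ∀ N m L : ℕ, 2 < N → m.Coprime N → N ^ 2 ≤ 2 ^ L →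
      c * (1 / Shor.lglg N) ≤ Shor.goodProb N m L) ∧
    (∀ C : ℝ, 0 < C → ∃ δ : ℝ, 0 < δ ∧ ∀ N m L : ℕ, 2 < N → m.Coprime N → N ^ 2 ≤ 2 ^ L →
      δ ≤ Shor.successProb N m L ⌈C * Shor.lglg N⌉₊) := by
  obtain ⟨c, hc, hgood⟩ := Shor.exists_pos_forall_mul_one_div_lglg_le_goodProb
  refine ⟨Shor.exists_antitone_forall_le_goodProb, ⟨c, hc, hgood⟩, fun C hC =>
    ⟨1 - Real.exp (-(c * C)), ?_, fun N m L hN hm hQ => ?_⟩⟩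
  · exact sub_pos.2 (Real.exp_lt_one_iff.2 (neg_neg_iff_pos.2 (mul_pos hc hC)))
  · exact Shor.one_sub_exp_neg_le_successProb hc.le
      (by linarith [Shor.half_le_lglg hN]) (hgood N m L hN hm hQ)

theorem mainTheorem1 :
    (∃ ε : ℕ → ℝ, Antitone ε ∧ (∀ P, 0 < ε P) ∧ Filter.Tendsto ε Filter.atTop (nhds 0) ∧
      ∀ N m L : ℕ, Shor.Setup N m L →
        4 / (Real.pi ^ 2 * Real.log 2) *
            ((Real.exp (-Real.eulerMascheroniConstant) - ε (Shor.period N m)) / Shor.lglg N) *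
            (1 - 1 / (N : ℝ)) ^ 2
          ≤ Shor.goodProb N m L) ∧
    (∃ c : ℝ, 0 < c ∧ ∀ N m L : ℕ, Shor.Setup N m L →
      c * (1 / Shor.lglg N) ≤ Shor.goodProb N m L) ∧
    (∀ C : ℝ, 0 < C → ∃ δ : ℝ, 0 < δ ∧ ∀ N m L : ℕ, Shor.Setup N m L →
      δ ≤ Shor.successProb N m L ⌈C * Shor.lglg N⌉₊) := by
  obtain ⟨⟨ε, hanti, hpos, hlim, hle⟩, ⟨c, hc, hgood⟩, hsuccess⟩ := mainTheorem1_general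
  refine ⟨⟨ε, hanti, hpos, hlim, fun N m L h => hle N m L h.two_lt h.coprime h.le_Q⟩,
    ⟨c, hc, fun N m L h => hgood N m L h.two_lt h.coprime h.le_Q⟩, fun C hC => ?_⟩
  obtain ⟨δ, hδ, hle⟩ := hsuccess C hC
  exact ⟨δ, hδ, fun N m L h => hle N m L h.two_lt h.coprime h.le_Q⟩
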